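/- Work over an algebraically closed field of characteristic zero. A \emph{toric surface} is the normal toric surface $X_\Sigma$ defined by a fan $\Sigma$ in $N_{\mathbb R}=\mathbb R^2$, $N=\mathbb Z^2$, and toric morphisms are given by homomorphisms of lattices compatible with the fans. A \emph{toric log del Pezzo surface} is a complete toric surface with at worst log terminal singularities whose anticanonical divisor is ample. On a smooth complete toric surface every $(-1)$-curve is torus-invariant. A \emph{toric blow-down} is a proper birational toric morphism between smooth toric surfaces that contracts exactly one curve, this curve being a $(-1)$-curve. Let $S$ be a toric log del Pezzo surface of Picard number one with minimal resolution $S'\to S$. We call $S$ \emph{basic} if $D^2\ge -2$ for every torus-invariant curve $D\subset S'$ that meets some $(-1)$-curve $C\ne D$ on $S'$. \textbf{Theorem.} Every toric log del Pezzo surface $S$ of Picard number one admits a cascade: there are an integer $t\ge 0$, toric surfaces $S_0,\dots,S_t$ with $S_t=S$, and a chain $$S'_t\xrightarrow{\ \phi_t\ }S'_{t-1}\xrightarrow{\ \phi_{t-1}\ }\cdots\xrightarrow{\ \phi_1\ }S'_0$$ of toric surfaces and toric morphisms such that (1) every $\phi_k$ $(1\le k\le t)$ is a toric blow-down; (2)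 for every $0\le k\le t$, $S'_k$ is the minimal resolution of $S_k$, via a toric morphism $\pi_k:S'_k\to S_k$; (3) for every $0\le k\le t$, $S_k$ is a toric log del Pezzo surface of Picard number one; (4) $S_0$ is basic. -/

import Mathlib

noncomputable section

namespace Toric

/-- The lattice `N ≅ ℤ²` of one-parameter subgroups of the two-dimensional torus. -/
abbrev N : Type := Fin 2 → ℤ

/-- The real plane `N_ℝ = N ⊗ ℝ`. -/
abbrev NR : Type := Fin 2 → ℝ

/-- The character lattice `M = Hom(N, ℤ)`. -/
abbrev M : Type := Module.Dual ℤ N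

/-- The inclusion `N ⊆ N_ℝ`. -/
def toReal (v : N) : NR := fun i => (v i : ℝ)

/-- The cone in `N_ℝ` generated by a finite set of lattice vectors. -/
def cone (s : Finset N) : PointedCone ℝ NR := PointedCone.hull ℝ (toReal '' (s : Set N))

/-- A vector of `N` is primitive if its coordinates are coprime. -/
def IsPrimitive (v : N) : Prop := IsCoprime (v 0) (v 1)

/-- A (normal, separated) toric surface `X = X_Σ`, given by its fan `Σ` in `N_ℝ = ℝ²`.
A strongly convex rational cone in the plane is simplicial, so it is the same thing as the finite
(linearly independent) set of the primitive generators of its rays; its faces are the cones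
generated by the subsets. `cones` is the set of all cones of the fan, recorded in this way. -/
structure ToricSurface where
  cones : Finset (Finset N)
  zero_mem : ∅ ∈ cones
  primitive : ∀ σ ∈ cones, ∀ v ∈ σ, IsPrimitive v
  stronglyConvex : ∀ σ ∈ cones, LinearIndependent ℝ (fun v : σ => toReal v)
  face_mem : ∀ σ ∈ cones, ∀ τ, τ ⊆ σ → τ ∈ cones
  inter_face : ∀ σ ∈ cones, ∀ τ ∈ cones, cone σ ⊓ cone τ = cone (σ ∩ τ)

namespace ToricSurface

/-- The primitive generators of the rays of the fan. The generator `v` stands for the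
torus-invariant curve `D_v`; two distinct such curves `D_u`, `D_v` meet if and only if
`{u, v}` is a cone of the fan. -/
def rays (X : ToricSurface) : Finset N := X.cones.biUnion id

/-- The support `|Σ|` of the fan. -/
def support (X : ToricSurface) : Set NR := {x | ∃ σ ∈ X.cones, x ∈ cone σ}

/-- `X` is complete: its fan covers the plane. -/
def IsComplete (X : ToricSurface) : Prop := X.support = Set.univ

/-- `X` is smooth: the generators of every cone are part of a `ℤ`-basis of `N`. -/
def IsSmooth (X : ToricSurface) : Prop :=
  ∀ σ ∈ X.cones, ∃ b : Module.Basis (Fin 2) ℤ N, (σ : Set N) ⊆ Set.range b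

/-- Torus-invariant Weil divisors `∑ a_v D_v`, written as `v ↦ a_v`. -/
abbrev Div (X : ToricSurface) : Type := X.rays → ℤ

/-- Torus-invariant Cartier divisors: on every affine chart `U_σ` the divisor is `div(χ^{-m})`
for some character `m`. -/
def cartierDiv (X : ToricSurface) : Submodule ℤ X.Div where
  carrier := {D | ∀ σ ∈ X.cones, ∃ m : M, ∀ v : X.rays, (v : N) ∈ σ → D v = -m v}
  zero_mem' := fun _ _ => ⟨0, fun _ _ => by simp⟩
  add_mem' := by
    intro D E hD hE σ hσ
    obtain ⟨m, hm⟩ := hD σ hσ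
    obtain ⟨n, hn⟩ := hE σ hσ
    refine ⟨m + n, fun v hv => ?_⟩
    simp only [Pi.add_apply, LinearMap.add_apply, hm v hv, hn v hv]
    ring
  smul_mem' := by
    intro c D hD σ hσ
    obtain ⟨m, hm⟩ := hD σ hσ
    refine ⟨c • m, fun v hv => ?_⟩
    simp only [Pi.smul_apply, LinearMap.smul_apply, hm v hv, smul_neg]

/-- The divisor `div(χ^m) = ∑ ⟨m, v⟩ D_v` of a character. -/
def divChar (X : ToricSurface) : M →ₗ[ℤ] X.Div where
  toFun m v := m v
  map_add' _ _ := rfl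
  map_smul' _ _ := rfl

/-- The Picard group: torus-invariant Cartier divisors modulo the divisors of characters. -/
abbrev Pic (X : ToricSurface) : Type :=
  X.cartierDiv ⧸ (LinearMap.range X.divChar).submoduleOf X.cartierDiv

/-- The Picard number: the rank of the Picard group (used for complete `X` only). -/
def picardNumber (X : ToricSurface) : ℕ := Module.finrank ℤ X.Pic

/-- The canonical divisor `K_X = -∑ D_v`. -/
def canonicalDiv (X : ToricSurface) : X.Div := fun _ => -1

/-- Ampleness of a torus-invariant Weil divisor `D` on a complete toric surface: some positive
multiple `nD` is Cartier with strictly convex support function. That is, for every maximal cone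
`σ` the sheaf `O(nD)` has a global section `χ^m` which generates it on the chart `U_σ`
(`⟨m, v⟩ = -n a_v` for `v ∈ σ`) and vanishes outside of `U_σ` (`⟨m, v⟩ > -n a_v` for `v ∉ σ`). -/
def IsAmple (X : ToricSurface) (D : X.Div) : Prop :=
  ∃ n : ℤ, 0 < n ∧ n • D ∈ X.cartierDiv ∧
    ∀ σ ∈ X.cones, σ.card = 2 →
      ∃ m : M, ∀ v : X.rays,
        ((v : N) ∈ σ → m v = -(n * D v)) ∧ ((v : N) ∉ σ → -(n * D v) < m v)

/-- Log terminal singularities: `K_X` is `ℚ`-Cartier, given on `U_σ` by the linear form `-m / n`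
with `⟨m, v⟩ = n` on the generators of `σ`, and the discrepancy `⟨m, w⟩ / n - 1` of the
toric divisor over `X` belonging to a primitive vector `w` of the cone is always `> -1`. -/
def IsLogTerminal (X : ToricSurface) : Prop :=
  ∀ σ ∈ X.cones, ∃ n : ℤ, 0 < n ∧ ∃ m : M, (∀ v ∈ σ, m v = n) ∧
    ∀ w : N, IsPrimitive w → toReal w ∈ cone σ → 0 < m w

/-- A toric log del Pezzo surface: a complete toric surface with log terminal singularities
whose anticanonical divisor is ample. -/
def IsLogDelPezzo (X : ToricSurface) : Prop :=
  X.IsComplete ∧ X.IsLogTerminal ∧ X.IsAmple (-X.canonicalDiv)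

/-- `D_v² = b`, for a complete torus-invariant curve `D_v` lying in the smooth locus of `X`.
Since `D_u · D_v` is `1` if `u ≠ v` span a cone and `0` if they do not, the relations
`div(χ^m) · D_v = 0` for all `m` say that `D_v²` is the integer `b` with
`b v + (sum of the neighbours of v) = 0`. -/
def HasSelfIntersection (X : ToricSurface) (v : N) (b : ℤ) : Prop :=
  b • v + ∑ u ∈ X.rays with u ≠ v ∧ {u, v} ∈ X.cones, u = 0

/-- A `(-1)`-curve. On a smooth complete toric surface an irreducible curve with negative
self-intersection is torus-invariant, and torus-invariant curves are smooth rational. -/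
def IsMinusOneCurve (X : ToricSurface) (v : N) : Prop :=
  v ∈ X.rays ∧ X.HasSelfIntersection v (-1)

end ToricSurface

/-- A toric morphism `X → Y`: a homomorphism of lattices mapping every cone of the fan of `X`
into a cone of the fan of `Y`. -/
structure ToricMorphism (X Y : ToricSurface) where
  toLinearMap : N →ₗ[ℤ] N
  map_cone : ∀ σ ∈ X.cones, ∃ τ ∈ Y.cones, ∀ v ∈ σ, toReal (toLinearMap v) ∈ cone τ

namespace ToricMorphism

variable {X Y : ToricSurface}

/-- A toric morphism is birational if and only if it is an isomorphism of lattices, and proper if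
and only if the preimage of the support of the fan of `Y` is the support of the fan of `X`
(the supports are finite unions of closed rational cones, so lattice points suffice). -/
def IsProperBirational (f : ToricMorphism X Y) : Prop :=
  Function.Bijective f.toLinearMap ∧
    ∀ v : N, toReal (f.toLinearMap v) ∈ Y.support → toReal v ∈ X.support

/-- For birational `f`: the curve `D_v` is contracted to a point by `f`, that is, the image of
its ray is not a ray of the fan of `Y`. -/
def IsExceptional (f : ToricMorphism X Y) (v : N) : Prop :=
  v ∈ X.rays ∧ f.toLinearMap v ∉ Y.rays

/-- `f` is the minimal resolution of `Y`: a proper birational morphism from a smooth surface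
that contracts no `(-1)`-curve. -/
def IsMinimalResolution (f : ToricMorphism X Y) : Prop :=
  X.IsSmooth ∧ f.IsProperBirational ∧ ∀ v, f.IsExceptional v → ¬ X.IsMinusOneCurve v

/-- `f` is a toric blow-down: a proper birational toric morphism of smooth toric surfaces which
contracts one `(-1)`-curve and no other curve. -/
def IsBlowDown (f : ToricMorphism X Y) : Prop :=
  X.IsSmooth ∧ Y.IsSmooth ∧ f.IsProperBirational ∧
    ∃ e, X.IsMinusOneCurve e ∧ ∀ v, f.IsExceptional v ↔ v = e

end ToricMorphism

namespace ToricSurface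

/-- A toric log del Pezzo surface of Picard number one. -/
def IsLogDelPezzoOfPicardNumberOne (S : ToricSurface) : Prop :=
  S.IsLogDelPezzo ∧ S.picardNumber = 1

/-- `S` is basic: on the minimal resolution `S'` of `S`, every torus-invariant curve `D_v`
meeting a `(-1)`-curve `D_e` satisfies `D_v² ≥ -2`. -/
def IsBasic (S : ToricSurface) : Prop :=
  ∃ (S' : ToricSurface) (π : ToricMorphism S' S), π.IsMinimalResolution ∧
    ∀ e v, S'.IsMinusOneCurve e → v ∈ S'.rays → v ≠ e → {v, e} ∈ S'.cones →
      ∀ b, S'.HasSelfIntersection v b → -2 ≤ b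

/-- `S` admits a cascade `S' = S'_t → S'_{t-1} → ⋯ → S'_0`. -/
def AdmitsCascade (S : ToricSurface) : Prop :=
  ∃ (t : ℕ) (T T' : ℕ → ToricSurface), T t = S ∧
    (∀ k ≤ t, (T k).IsLogDelPezzoOfPicardNumberOne) ∧
    (∀ k ≤ t, ∃ π : ToricMorphism (T' k) (T k), π.IsMinimalResolution) ∧
    (∀ k < t, ∃ φ : ToricMorphism (T' (k + 1)) (T' k), φ.IsBlowDown) ∧
    (T 0).IsBasic

end ToricSurface

end Toric

end

/-!
A complete toric surface has Picard number one if and only if its fan has three rays, and then it is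
automatically a log del Pezzo surface (`isLogDelPezzoOfPicardNumberOne_iff`). The minimal resolution
of `S` is a smooth refinement `X` of the fan of `S` in which no additional ray is a `(-1)`-curve
(`IsMinimalRefinement`, `exists_isMinimalRefinement`). So the theorem is about such refinements, and
it follows by induction on the number of rays of `X`.

If `S` is not basic, then on `X` a `(-1)`-curve `D_e` meets a curve `D_w` with `D_w² ≤ -3`. By
minimality `e` is a ray of `S`. Let `w'` be the other neighbour of `e`, so that `w + w' = e`, and let
`u₁`, `u₂` be the other rays of `S`, with `w` in the cone on `e` and `u₁` and `w'` in the cone on `e`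
and `u₂`. Let `Y` be the contraction of `D_e`, and `Z` the surface with the rays `u₁`, `u₂`, `w'`.
Among the curves of `Y` outside of `Z`, at most `D_w` has changed its self-intersection, to
`D_w² + 1 ≤ -2`; hence `Y` is again a minimal resolution of `Z`
(`IsMinimalRefinement.exists_contraction`).

The point that needs an argument is that `u₁`, `u₂`, `w'` are the rays of a complete fan, that is,
that `e` lies between `u₁` and `w'`. Write `w = a e + b u₁`; then `(1 - a) e = w' + b u₁`, so the
claim is that `a < 1`. This is `IsMinimalRefinement.coord_lt_one`, a maximum principle: the
exceptional rays satisfy `p + q = c v` with `c ≥ 2`, where `p` and `q` are the neighbours of `v`.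

Fans are handled through their conical coordinates (`IsConical`): sets of primitive vectors form a
fan exactly if every point has at most one tuple of nonnegative coefficients supported on one of
them, and the fan is complete exactly if every point has one. In this form the fan axioms and
completeness pass through star subdivisions in both directions (`IsStarSubdivision`), and the fans
`X`, `Y`, `Z` are all reached by such steps. All morphisms are given by the identity of the lattice.
-/

namespace Toric

/-! ### Plane geometry, cones and conical coordinates -/

/-- The determinant of two vectors of the plane. -/
def cross {R : Type*} [CommRing R] (x y : Fin 2 → R) : R := x 0 * y 1 - x 1 * y 0

section Cross

variable {R : Type*} [CommRing R] (x y z : Fin 2 → R) (c : R)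

theorem cross_self : cross x x = 0 := by simp only [cross]; ring

theorem cross_swap : cross x y = -cross y x := by simp only [cross]; ring

theorem cross_add_left : cross (x + y) z = cross x z + cross y z := by
  simp only [cross, Pi.add_apply]; ring

theorem cross_add_right : cross x (y + z) = cross x y + cross x z := by
  simp only [cross, Pi.add_apply]; ring

theorem cross_smul_left : cross (c • x) y = c * cross x y := by
  simp only [cross, Pi.smul_apply, smul_eq_mul]; ring

theorem cross_smul_right : cross x (c • y) = c * cross x y := by
  simp only [cross, Pi.smul_apply, smul_eq_mul]; ring

/-- Cramer's rule. -/
theorem cross_smul_eq : cross x y • z = cross z y • x + cross x z • y := by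
  ext i
  fin_cases i <;> simp [cross] <;> ring

end Cross

theorem toReal_add (u v : N) : toReal (u + v) = toReal u + toReal v := by
  ext i; simp [toReal]

theorem toReal_zsmul (c : ℤ) (u : N) : toReal (c • u) = (c : ℝ) • toReal u := by
  ext i; simp [toReal]

theorem toReal_zero : toReal 0 = 0 := by ext i; simp [toReal]

theorem toReal_injective : Function.Injective toReal := fun u v h => by
  ext i
  have := congrFun h i
  simpa [toReal] using this

theorem cross_toReal (u v : N) : cross (toReal u) (toReal v) = ((cross u v : ℤ) : ℝ) := by
  simp [cross, toReal]

theorem IsPrimitive.ne_zero {v : N} (hv : IsPrimitive v) : v ≠ 0 := by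
  rintro rfl
  exact not_isCoprime_zero_zero hv

theorem IsPrimitive.exists_cross_eq_one {v : N} (hv : IsPrimitive v) : ∃ w, cross v w = 1 := by
  obtain ⟨a, b, h⟩ := hv
  exact ⟨![-b, a], by simp [cross]; linarith⟩

theorem isPrimitive_of_cross_eq_one {v w : N} (h : cross v w = 1) : IsPrimitive v :=
  ⟨w 1, -w 0, by rw [← h, cross]; ring⟩

/-- A lattice vector on the line through a primitive vector is an integral multiple of it. -/
theorem IsPrimitive.eq_zsmul_of_cross_eq_zero {v w : N} (hv : IsPrimitive v)
    (h : cross v w = 0) : ∃ c : ℤ, w = c • v := by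
  obtain ⟨u, hu⟩ := hv.exists_cross_eq_one
  refine ⟨cross w u, ?_⟩
  have := cross_smul_eq v u w
  rwa [hu, h, one_smul, zero_smul, add_zero] at this

/-- A ray contains only one primitive vector. -/
theorem IsPrimitive.eq_of_toReal_eq_smul {v w : N} (hv : IsPrimitive v) (hw : IsPrimitive w)
    {c : ℝ} (hc : 0 ≤ c) (h : toReal w = c • toReal v) : w = v := by
  have h0 : cross v w = 0 := by
    have : ((cross v w : ℤ) : ℝ) = 0 := by
      rw [← cross_toReal, h, cross_smul_right _ _ c, cross_self, mul_zero]
    exact_mod_cast this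
  obtain ⟨k, rfl⟩ := hv.eq_zsmul_of_cross_eq_zero h0
  have hk : k ∣ 1 := by
    obtain ⟨a, b, h1⟩ := hw
    exact ⟨a * v 0 + b * v 1, by rw [← h1]; simp only [Pi.smul_apply, smul_eq_mul]; ring⟩
  have hk' : (k : ℝ) = c := by
    rw [toReal_zsmul, ← sub_eq_zero, ← sub_smul, smul_eq_zero] at h
    rcases h with h | h
    · linarith
    · exact absurd (toReal_injective (h.trans toReal_zero.symm)) hv.ne_zero
  have : 0 ≤ k := by exact_mod_cast hk'.symm ▸ hc
  have : k = 1 := by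
    have := Int.le_of_dvd one_pos hk
    rcases (by omega : k = 0 ∨ k = 1) with rfl | rfl
    · simp at hk
    · rfl
  rw [this, one_smul]

/-- The point of the plane with given coefficients: `f ↦ ∑ f v • v`. -/
noncomputable def realize : (N →₀ ℝ) →ₗ[ℝ] NR := Finsupp.linearCombination ℝ toReal

@[simp]
theorem realize_single (v : N) (c : ℝ) : realize (Finsupp.single v c) = c • toReal v :=
  Finsupp.linearCombination_single ℝ c v

theorem realize_eq_sum {f : N →₀ ℝ} {σ : Finset N} (h : f.support ⊆ σ) :
    realize f = ∑ v ∈ σ, f v • toReal v :=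
  Finsupp.sum_of_support_subset f h _ (by simp)

theorem mem_cone_iff {σ : Finset N} {x : NR} :
    x ∈ cone σ ↔ ∃ f : N →₀ ℝ, (∀ v, 0 ≤ f v) ∧ f.support ⊆ σ ∧ realize f = x := by
  constructor
  · intro hx
    induction hx using Submodule.span_induction with
    | mem x hx =>
      obtain ⟨v, hv, rfl⟩ := hx
      refine ⟨Finsupp.single v 1, fun w => ?_, ?_, by simp⟩
      · rw [Finsupp.single_apply]; split_ifs <;> simp
      · exact Finsupp.support_single_subset.trans (by simpa using hv)
    | zero => exact ⟨0, by simp, by simp, by simp⟩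
    | add x y _ _ hx hy =>
      obtain ⟨f, hf, hf', rfl⟩ := hx
      obtain ⟨g, hg, hg', rfl⟩ := hy
      exact ⟨f + g, fun v => add_nonneg (hf v) (hg v),
        Finsupp.support_add.trans (Finset.union_subset hf' hg'), map_add _ _ _⟩
    | smul c x _ hx =>
      obtain ⟨f, hf, hf', rfl⟩ := hx
      exact ⟨(c : ℝ) • f, fun v => mul_nonneg c.2 (hf v), Finsupp.support_smul.trans hf',
        map_smul _ _ _⟩
  · rintro ⟨f, hf, hf', rfl⟩
    rw [realize_eq_sum hf']
    exact Submodule.sum_mem _ fun v hv =>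
      (cone σ).smul_mem (hf v)
        (Submodule.subset_span (Set.mem_image_of_mem _ hv))

theorem toReal_mem_cone {σ : Finset N} {v : N} (hv : v ∈ σ) : toReal v ∈ cone σ :=
  Submodule.subset_span (Set.mem_image_of_mem _ hv)

theorem smul_mem_cone {σ : Finset N} {x : NR} {c : ℝ} (hc : 0 ≤ c) (hx : x ∈ cone σ) :
    c • x ∈ cone σ :=
  (cone σ).smul_mem hc hx

theorem cone_mono {σ τ : Finset N} (h : σ ⊆ τ) : cone σ ≤ cone τ :=
  Submodule.span_mono (Set.image_mono (by exact_mod_cast h))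

/-- If the generators of `σ` lie in `cone τ`, then so does all of `cone σ`. -/
theorem cone_le {σ τ : Finset N} (h : ∀ v ∈ σ, toReal v ∈ cone τ) : cone σ ≤ cone τ :=
  Submodule.span_le.2 (by rintro _ ⟨v, hv, rfl⟩; exact h v hv)

theorem mem_cone_pair {u v : N} {x : NR} :
    x ∈ cone {u, v} ↔ ∃ a b : ℝ, 0 ≤ a ∧ 0 ≤ b ∧ x = a • toReal u + b • toReal v := by
  constructor
  · intro hx
    rw [cone, PointedCone.hull, Finset.coe_pair, Set.image_pair, Submodule.mem_span_pair] at hx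
    obtain ⟨a, b, rfl⟩ := hx
    exact ⟨a, b, a.2, b.2, rfl⟩
  · rintro ⟨a, b, ha, hb, rfl⟩
    exact add_mem (smul_mem_cone ha (toReal_mem_cone (by simp)))
      (smul_mem_cone hb (toReal_mem_cone (by simp)))

/-- Coefficients that are nonnegative and supported on one of the cones in `C`. For the cones of a
fan, they are coordinates on its support. -/
def IsConical (C : Finset (Finset N)) (f : N →₀ ℝ) : Prop :=
  (∀ v, 0 ≤ f v) ∧ f.support ∈ C

theorem isConical_of_subset {C : Finset (Finset N)} (hC : ∀ σ ∈ C, ∀ τ, τ ⊆ σ → τ ∈ C)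
    {f : N →₀ ℝ} (hf : ∀ v, 0 ≤ f v) {σ : Finset N} (hσ : σ ∈ C) (h : f.support ⊆ σ) :
    IsConical C f :=
  ⟨hf, hC σ hσ _ h⟩

namespace ToricSurface

variable (X : ToricSurface)

variable {X} in
theorem isConical {f : N →₀ ℝ} (hf : ∀ v, 0 ≤ f v) {σ : Finset N} (hσ : σ ∈ X.cones)
    (h : f.support ⊆ σ) : IsConical X.cones f :=
  isConical_of_subset X.face_mem hf hσ h

theorem eq_of_realize_eq_of_support_subset {σ : Finset N} (hσ : σ ∈ X.cones) {f g : N →₀ ℝ}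
    (hf : f.support ⊆ σ) (hg : g.support ⊆ σ) (h : realize f = realize g) : f = g := by
  have := X.stronglyConvex σ hσ
  have h2 : LinearIndepOn ℝ toReal (σ : Set N) := this
  exact linearIndepOn_iffₛ.1 h2 f hf g hg h

variable {X} in
/-- A point of the support of a fan has only one tuple of conical coordinates. -/
theorem eq_of_realize_eq {f g : N →₀ ℝ} (hf : IsConical X.cones f) (hg : IsConical X.cones g)
    (h : realize f = realize g) : f = g := by
  have hx : realize f ∈ cone (f.support ∩ g.support) := by
    rw [← X.inter_face _ hf.2 _ hg.2]
    exact ⟨mem_cone_iff.2 ⟨f, hf.1, subset_rfl, rfl⟩, mem_cone_iff.2 ⟨g, hg.1, subset_rfl, h.symm⟩⟩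
  obtain ⟨k, hk, hks, hkx⟩ := mem_cone_iff.1 hx
  rw [X.eq_of_realize_eq_of_support_subset hf.2 subset_rfl
      (hks.trans Finset.inter_subset_left) hkx.symm,
    X.eq_of_realize_eq_of_support_subset hg.2 subset_rfl
      (hks.trans Finset.inter_subset_right) (h.symm.trans hkx.symm)]

theorem isComplete_iff :
    X.IsComplete ↔ ∀ x, ∃ f, IsConical X.cones f ∧ realize f = x := by
  rw [IsComplete, Set.eq_univ_iff_forall]
  refine forall_congr' fun x => ⟨?_, ?_⟩
  · rintro ⟨σ, hσ, hx⟩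
    obtain ⟨f, hf, hs, rfl⟩ := mem_cone_iff.1 hx
    exact ⟨f, isConical hf hσ hs, rfl⟩
  · rintro ⟨f, hf, rfl⟩
    exact ⟨f.support, hf.2, mem_cone_iff.2 ⟨f, hf.1, subset_rfl, rfl⟩⟩

/-- A collection of sets of primitive vectors that is closed under subsets is a fan as soon as
conical coordinates are unique. -/
def ofUnique (C : Finset (Finset N)) (h0 : ∅ ∈ C) (hp : ∀ σ ∈ C, ∀ v ∈ σ, IsPrimitive v)
    (hC : ∀ σ ∈ C, ∀ τ, τ ⊆ σ → τ ∈ C)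
    (hu : ∀ f g, IsConical C f → IsConical C g → realize f = realize g → f = g) :
    ToricSurface where
  cones := C
  zero_mem := h0
  primitive := hp
  face_mem := hC
  stronglyConvex := fun σ hσ => by
    change LinearIndepOn ℝ toReal (σ : Set N)
    rw [linearIndepOn_iff]
    intro l hl h
    -- the positive and the negative part of `l` are conical coordinates of the same point
    set p : N →₀ ℝ := l.mapRange (fun t => max t 0) (by simp)
    set q : N →₀ ℝ := l.mapRange (fun t => max (-t) 0) (by simp)
    have hl' : l = p - q := by
      ext v
      simp only [p, q, Finsupp.sub_apply, Finsupp.mapRange_apply]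
      rcases le_total 0 (l v) with h | h <;> simp [h]
    have hpq : p = q := by
      refine hu p q (isConical_of_subset hC (fun v => by simp [p]) hσ
          (Finsupp.support_mapRange.trans hl))
        (isConical_of_subset hC (fun v => by simp [q]) hσ (Finsupp.support_mapRange.trans hl)) ?_
      rw [← sub_eq_zero, ← map_sub, ← hl']
      exact h
    rw [hl', hpq, sub_self]
  inter_face := fun σ hσ τ hτ => by
    refine le_antisymm ?_ (le_inf (cone_mono Finset.inter_subset_left)
      (cone_mono Finset.inter_subset_right))
    rintro x ⟨hx, hx'⟩
    obtain ⟨f, hf, hfσ, rfl⟩ := mem_cone_iff.1 hx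
    obtain ⟨g, hg, hgτ, h⟩ := mem_cone_iff.1 hx'
    obtain rfl := hu f g (isConical_of_subset hC hf hσ hfσ) (isConical_of_subset hC hg hτ hgτ)
      h.symm
    exact mem_cone_iff.2 ⟨f, hf, Finset.subset_inter hfσ hgτ, rfl⟩

variable {X}

theorem mem_rays {v : N} : v ∈ X.rays ↔ {v} ∈ X.cones := by
  simp only [rays, Finset.mem_biUnion, id]
  exact ⟨fun ⟨σ, hσ, hv⟩ => X.face_mem σ hσ _ (by simpa using hv), fun h => ⟨_, h, by simp⟩⟩

theorem mem_rays_of_mem {σ : Finset N} (hσ : σ ∈ X.cones) {v : N} (hv : v ∈ σ) : v ∈ X.rays :=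
  mem_rays.2 (X.face_mem σ hσ _ (by simpa using hv))

theorem isPrimitive {v : N} (hv : v ∈ X.rays) : IsPrimitive v :=
  X.primitive _ (mem_rays.1 hv) v (by simp)

theorem card_le_two {σ : Finset N} (hσ : σ ∈ X.cones) : σ.card ≤ 2 := by
  simpa using (X.stronglyConvex σ hσ).fintype_card_le_finrank

/-- A ray that meets a cone of the fan is an edge of it. -/
theorem mem_of_toReal_mem_cone {σ : Finset N} (hσ : σ ∈ X.cones) {v : N} (hv : v ∈ X.rays)
    (h : toReal v ∈ cone σ) : v ∈ σ := by
  obtain ⟨f, hf, hs, hx⟩ := mem_cone_iff.1 h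
  have : f = Finsupp.single v 1 := by
    refine eq_of_realize_eq (isConical hf hσ hs) (isConical ?_ (mem_rays.1 hv)
      Finsupp.support_single_subset) (by simpa using hx)
    intro w
    rw [Finsupp.single_apply]; split_ifs <;> simp
  exact hs (by rw [this]; simp)

theorem cross_ne_zero {u v : N} (h : {u, v} ∈ X.cones) (huv : u ≠ v) : cross u v ≠ 0 := by
  intro h0
  have hu := X.primitive _ h u (by simp)
  have hv := X.primitive _ h v (by simp)
  obtain ⟨k, hk⟩ := hu.eq_zsmul_of_cross_eq_zero h0
  have := X.eq_of_realize_eq_of_support_subset h (f := Finsupp.single v 1)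
    (g := Finsupp.single u (k : ℝ)) (Finsupp.support_single_subset.trans (by simp))
    (Finsupp.support_single_subset.trans (by simp)) (by
      simp only [realize_single, one_smul]
      rw [← toReal_zsmul, ← hk])
  have := DFunLike.congr_fun this v
  simp [huv] at this

/-- A two-dimensional cone containing `v` consists of `v` and one more vector. -/
theorem eq_singleton_or_pair {σ : Finset N} (hσ : σ ∈ X.cones) {v : N} (hv : v ∈ σ) :
    σ = {v} ∨ ∃ u, u ≠ v ∧ σ = {v, u} := by
  have h2 := card_le_two hσ
  have h1 : (σ.erase v).card ≤ 1 := by rw [Finset.card_erase_of_mem hv]; omega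
  rw [← Finset.insert_erase hv]
  rcases Finset.card_le_one_iff_subset_singleton.1 h1 with ⟨u, hu⟩
  rcases Finset.subset_singleton_iff.1 hu with h | h
  · exact Or.inl (by rw [h]; rfl)
  · refine Or.inr ⟨u, ?_, by rw [h]⟩
    have : u ∈ σ.erase v := by rw [h]; simp
    exact (Finset.mem_erase.1 this).1

end ToricSurface

/-! ### Neighbours of a torus-invariant curve -/

/-- Taking the determinant with a fixed vector, as a linear form. -/
def crossForm (x : NR) : NR →ₗ[ℝ] ℝ where
  toFun := cross x
  map_add' := cross_add_right x
  map_smul' c y := cross_smul_right x y c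

theorem cross_realize (x : NR) {f : N →₀ ℝ} {σ : Finset N} (h : f.support ⊆ σ) :
    cross x (realize f) = ∑ v ∈ σ, f v * cross x (toReal v) := by
  change crossForm x (realize f) = _
  rw [realize_eq_sum h, map_sum]
  exact Finset.sum_congr rfl fun v _ => map_smul _ _ _

namespace ToricSurface

variable {X : ToricSurface}

/-- On a complete toric surface every torus-invariant curve has a neighbour on each side. A cone
that contains `n v + p` for infinitely many `n` has `v` as an edge, and its other edge lies on the
side of `p`. -/
theorem exists_neighbour (hX : X.IsComplete) {v : N} (hv : v ∈ X.rays) {s : ℝ} (hs : s ≠ 0) :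
    ∃ p, {v, p} ∈ X.cones ∧ 0 < s * cross (toReal v) (toReal p) := by
  obtain ⟨w, hw⟩ := (isPrimitive hv).exists_cross_eq_one
  choose F hF hFx using X.isComplete_iff.1 hX
  let x : ℕ → NR := fun n => (n : ℝ) • toReal v + s • toReal w
  obtain ⟨⟨σ, hσ⟩, hinf⟩ := Finite.exists_infinite_fiber
    (fun n : ℕ => (⟨(F (x n)).support, (hF (x n)).2⟩ : X.cones))
  rw [Set.infinite_coe_iff] at hinf
  have hsupp : ∀ n ∈ ((fun n : ℕ => (⟨(F (x n)).support, (hF (x n)).2⟩ : X.cones)) ⁻¹' {⟨σ, hσ⟩}),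
      (F (x n)).support = σ := fun n hn => congrArg Subtype.val hn
  obtain ⟨n₀, hn₀⟩ := hinf.nonempty
  obtain ⟨n₁, hn₁, hlt⟩ := hinf.exists_gt n₀
  have h0 := hsupp _ hn₀
  have h1 := hsupp _ hn₁
  have hpos : (0 : ℝ) < n₁ - n₀ := sub_pos.2 (by exact_mod_cast hlt)
  set g : N →₀ ℝ := ((n₁ : ℝ) - n₀)⁻¹ • (F (x n₁) - F (x n₀)) with hg
  have hgσ : g.support ⊆ σ := Finsupp.support_smul.trans
    ((Finsupp.support_sub).trans (by rw [h0, h1, Finset.union_self]))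
  have hgx : realize g = toReal v := by
    rw [hg, map_smul, map_sub, hFx, hFx]
    simp only [x]
    rw [add_sub_add_right_eq_sub, ← sub_smul, smul_smul, inv_mul_cancel₀ hpos.ne', one_smul]
  -- on the cone `σ` the coordinates of `k v + p` are affine in `k` with slope `g`
  have hk : ∀ k ∈ ((fun n : ℕ => (⟨(F (x n)).support, (hF (x n)).2⟩ : X.cones)) ⁻¹' {⟨σ, hσ⟩}),
      F (x k) = F (x n₀) + ((k : ℝ) - n₀) • g := by
    intro k hk
    refine X.eq_of_realize_eq_of_support_subset hσ (hsupp k hk).le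
      (Finsupp.support_add.trans (Finset.union_subset h0.le (Finsupp.support_smul.trans hgσ))) ?_
    rw [map_add, map_smul, hFx, hFx, hgx]
    simp only [x]
    module
  have hg0 : ∀ r, 0 ≤ g r := by
    intro r
    by_contra! hr
    obtain ⟨M, hM⟩ := exists_nat_gt (n₀ + F (x n₀) r / -g r)
    obtain ⟨k, hk', hMk⟩ := hinf.exists_gt M
    have h3 := (hF (x k)).1 r
    rw [hk k hk'] at h3
    simp only [Finsupp.add_apply, Finsupp.smul_apply, smul_eq_mul] at h3
    have h4 : F (x n₀) r / -g r < (k : ℝ) - n₀ := by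
      have : (M : ℝ) < k := by exact_mod_cast hMk
      linarith
    rw [div_lt_iff₀ (by linarith)] at h4
    linarith
  have hvσ : v ∈ σ := mem_of_toReal_mem_cone hσ hv (mem_cone_iff.2 ⟨g, hg0, hgσ, hgx⟩)
  have hsum : ∑ r ∈ σ, F (x n₀) r * cross (toReal v) (toReal r) = s := by
    rw [← cross_realize _ h0.le, hFx]
    simp only [x]
    rw [cross_add_right, cross_smul_right, cross_smul_right, cross_self, cross_toReal, hw]
    simp
  by_contra! hcon
  have : s * s ≤ 0 := by
    nth_rw 2 [← hsum]
    rw [Finset.mul_sum]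
    refine Finset.sum_nonpos fun r hr => ?_
    have h5 := hcon r (X.face_mem σ hσ _ (by
      intro z hz
      rcases Finset.mem_insert.1 hz with rfl | hz
      · exact hvσ
      · rwa [Finset.mem_singleton.1 hz]))
    have h6 := mul_nonneg ((hF (x n₀)).1 r) (neg_nonneg.2 h5)
    linarith
  have := mul_self_pos.2 hs
  linarith

theorem neighbour_eq_of_toReal_eq {v p p' : N} (h : {v, p} ∈ X.cones) (hp' : p' ∈ X.rays)
    (hne : p' ≠ v) {c d : ℝ} (hc : 0 ≤ c) (hd : 0 ≤ d)
    (heq : toReal p' = c • toReal v + d • toReal p) : p' = p := by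
  have := mem_of_toReal_mem_cone h hp' (mem_cone_pair.2 ⟨c, d, hc, hd, heq⟩)
  simpa [hne] using this

/-- Two neighbours of a torus-invariant curve on the same side are equal. -/
theorem neighbour_unique {v p p' : N} (h : {v, p} ∈ X.cones) (h' : {v, p'} ∈ X.cones)
    (hpos : 0 < cross v p * cross v p') : p' = p := by
  have hpv : p ≠ v := by rintro rfl; simp [cross_self] at hpos
  have hpv' : p' ≠ v := by rintro rfl; simp [cross_self] at hpos
  have hP : ((cross v p : ℤ) : ℝ) ≠ 0 := by
    intro h0; rw [Int.cast_eq_zero.1 h0] at hpos; simp at hpos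
  set d : ℝ := ((cross v p' : ℤ) : ℝ) / ((cross v p : ℤ) : ℝ) with hd
  set c : ℝ := ((cross p' p : ℤ) : ℝ) / ((cross v p : ℤ) : ℝ) with hc
  have hd0 : 0 < d := by
    rw [hd, div_eq_mul_inv, ← mul_pos_iff_of_pos_right (mul_self_pos.2 hP)]
    have : (0 : ℝ) < (cross v p : ℤ) * (cross v p' : ℤ) := by exact_mod_cast hpos
    field_simp
    linarith
  have heq : toReal p' = c • toReal v + d • toReal p := by
    have h3 := cross_smul_eq (toReal v) (toReal p) (toReal p')
    simp only [cross_toReal] at h3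
    rw [hc, hd, div_eq_inv_mul, div_eq_inv_mul, mul_smul, mul_smul, ← smul_add, ← h3, smul_smul,
      inv_mul_cancel₀ hP, one_smul]
  rcases le_total 0 c with h0 | h0
  · exact neighbour_eq_of_toReal_eq h (mem_rays_of_mem h' (by simp)) hpv' h0 hd0.le heq
  · refine (neighbour_eq_of_toReal_eq h' (mem_rays_of_mem h (by simp)) hpv (c := -c / d)
      (d := 1 / d) (div_nonneg (by linarith) hd0.le) (by positivity) ?_).symm
    rw [heq, smul_add, smul_smul, smul_smul, ← add_assoc, ← add_smul]
    have h5 : -c / d + 1 / d * c = 0 := by ring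
    have h6 : 1 / d * d = 1 := by field_simp
    rw [h5, h6, zero_smul, one_smul, zero_add]

theorem exists_neighbours (hX : X.IsComplete) {v : N} (hv : v ∈ X.rays) :
    ∃ p q, {v, p} ∈ X.cones ∧ {v, q} ∈ X.cones ∧ 0 < cross v p ∧ cross v q < 0 ∧
      ∀ u, u ≠ v → {v, u} ∈ X.cones → u = p ∨ u = q := by
  obtain ⟨p, hp, hp'⟩ := exists_neighbour hX hv (one_ne_zero)
  obtain ⟨q, hq, hq'⟩ := exists_neighbour hX hv (neg_ne_zero.2 one_ne_zero)
  rw [cross_toReal] at hp' hq'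
  have h1 : 0 < cross v p := by
    have : (0 : ℝ) < (cross v p : ℤ) := by linarith
    exact_mod_cast this
  have h2 : cross v q < 0 := by
    have : ((cross v q : ℤ) : ℝ) < 0 := by linarith
    exact_mod_cast this
  refine ⟨p, q, hp, hq, h1, h2, fun u hu hc => ?_⟩
  rcases lt_or_gt_of_ne (cross_ne_zero hc hu.symm) with h | h
  · exact Or.inr (neighbour_unique hq hc (mul_pos_of_neg_of_neg h2 h))
  · exact Or.inl (neighbour_unique hp hc (mul_pos h1 h))

theorem exists_basis_of_isUnit_cross {u v : N} (h : IsUnit (cross u v)) :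
    ∃ b : Module.Basis (Fin 2) ℤ N, (({u, v} : Finset N) : Set N) ⊆ Set.range b := by
  have h2 : IsUnit ((Pi.basisFun ℤ (Fin 2)).det ![u, v]) := by
    have : (Pi.basisFun ℤ (Fin 2)).det ![u, v] = cross u v := by
      rw [Module.Basis.det_apply, Matrix.det_fin_two]
      simp [Module.Basis.toMatrix_apply, cross]
      ring
    rwa [this]
  rw [← Module.Basis.is_basis_iff_det] at h2
  refine ⟨Module.Basis.mk h2.1 h2.2.ge, ?_⟩
  rw [Module.Basis.coe_mk, Finset.coe_pair, Matrix.range_cons, Matrix.range_cons,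
    Matrix.range_empty, Set.union_empty]
  rfl

theorem isSmooth_iff :
    X.IsSmooth ↔ ∀ u v, u ≠ v → {u, v} ∈ X.cones → IsUnit (cross u v) := by
  constructor
  · intro h u v huv hσ
    obtain ⟨b, hb⟩ := h _ hσ
    obtain ⟨i, hi⟩ := hb (by simp : u ∈ _)
    obtain ⟨j, hj⟩ := hb (by simp : v ∈ _)
    have hu := (Pi.basisFun ℤ (Fin 2)).isUnit_det b
    have hd : (Pi.basisFun ℤ (Fin 2)).det b = cross (b 0) (b 1) := by
      rw [Module.Basis.det_apply, Matrix.det_fin_two]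
      simp [Module.Basis.toMatrix_apply, cross]
      ring
    rw [hd] at hu
    have hij : i ≠ j := by rintro rfl; exact huv (hi.symm.trans hj)
    rcases (by omega : (i = 0 ∧ j = 1) ∨ (i = 1 ∧ j = 0)) with ⟨rfl, rfl⟩ | ⟨rfl, rfl⟩
    · rwa [← hi, ← hj]
    · rw [← hi, ← hj, cross_swap]; exact hu.neg
  · intro h σ hσ
    rcases σ.eq_empty_or_nonempty with rfl | ⟨v, hv⟩
    · exact ⟨Pi.basisFun ℤ (Fin 2), by simp⟩
    rcases eq_singleton_or_pair hσ hv with rfl | ⟨u, hu, rfl⟩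
    · obtain ⟨w, hw⟩ := (X.primitive _ hσ v hv).exists_cross_eq_one
      obtain ⟨b, hb⟩ := exists_basis_of_isUnit_cross (u := v) (v := w) (by rw [hw]; exact isUnit_one)
      exact ⟨b, subset_trans (by simp) hb⟩
    · exact exists_basis_of_isUnit_cross (h _ _ hu.symm hσ)

/-- On a smooth complete toric surface the curve `D_v` has exactly two neighbours `D_p` and `D_q`,
and `p + q = b v` with `b = -D_v²`. -/
theorem exists_neighbours_of_isSmooth (hX : X.IsComplete) (hs : X.IsSmooth) {v : N}
    (hv : v ∈ X.rays) :
    ∃ (p q : N) (b : ℤ), p ≠ v ∧ q ≠ v ∧ p ≠ q ∧ {p, v} ∈ X.cones ∧ {q, v} ∈ X.cones ∧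
      p + q = b • v ∧ {u ∈ X.rays | u ≠ v ∧ {u, v} ∈ X.cones} = {p, q} ∧
      ∀ c, X.HasSelfIntersection v c ↔ c = -b := by
  obtain ⟨p, q, hp, hq, h1, h2, hu⟩ := exists_neighbours hX hv
  have hpv : p ≠ v := by rintro rfl; simp [cross_self] at h1
  have hqv : q ≠ v := by rintro rfl; simp [cross_self] at h2
  have hpq : p ≠ q := by rintro rfl; omega
  have e1 : cross v p = 1 := by
    rcases Int.isUnit_iff.1 (isSmooth_iff.1 hs _ _ hpv.symm hp) with h | h <;> omega
  have e2 : cross v q = -1 := by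
    rcases Int.isUnit_iff.1 (isSmooth_iff.1 hs _ _ hqv.symm hq) with h | h <;> omega
  obtain ⟨b, hb⟩ := (isPrimitive hv).eq_zsmul_of_cross_eq_zero (w := p + q)
    (by rw [cross_add_right, e1, e2]; rfl)
  have hfil : {u ∈ X.rays | u ≠ v ∧ {u, v} ∈ X.cones} = {p, q} := by
    ext u
    simp only [Finset.mem_filter, Finset.mem_insert, Finset.mem_singleton]
    constructor
    · rintro ⟨-, h3, h4⟩
      exact hu u h3 (by rwa [Finset.pair_comm])
    · rintro (rfl | rfl)
      · exact ⟨mem_rays_of_mem hp (by simp), hpv, by rwa [Finset.pair_comm]⟩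
      · exact ⟨mem_rays_of_mem hq (by simp), hqv, by rwa [Finset.pair_comm]⟩
  refine ⟨p, q, b, hpv, hqv, hpq, by rwa [Finset.pair_comm], by rwa [Finset.pair_comm], hb, hfil,
    fun c => ?_⟩
  rw [HasSelfIntersection, hfil, Finset.sum_pair hpq, hb, ← add_smul, smul_eq_zero]
  have := (isPrimitive hv).ne_zero
  simp only [this, or_false]
  omega

end ToricSurface

/-! ### Star subdivisions -/

/-- The coefficients of the linear relation `w - a u - b v = 0`. -/
noncomputable def starRelation (u v w : N) (a b : ℝ) : N →₀ ℝ :=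
  Finsupp.single w 1 - Finsupp.single u a - Finsupp.single v b

/-- The collection of cones `F` arises from `C` by the star subdivision of the cone `{u, v}` along
the ray through `w = a u + b v`. -/
structure IsStarSubdivision (F C : Finset (Finset N)) (u v w : N) (a b : ℝ) : Prop where
  ne : u ≠ v
  ne_left : u ≠ w
  ne_right : v ≠ w
  left_pos : 0 < a
  right_pos : 0 < b
  eq : toReal w = a • toReal u + b • toReal v
  mem_fine : ∀ σ, σ ∈ F ↔ (σ ∈ C ∧ ¬ {u, v} ⊆ σ) ∨ (w ∈ σ ∧ (σ ⊆ {u, w} ∨ σ ⊆ {v, w}))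
  mem_coarse : ∀ σ, σ ∈ C ↔ (σ ∈ F ∧ w ∉ σ) ∨ σ = {u, v}
  face_fine : ∀ σ ∈ F, ∀ τ, τ ⊆ σ → τ ∈ F
  face_coarse : ∀ σ ∈ C, ∀ τ, τ ⊆ σ → τ ∈ C

namespace IsStarSubdivision

variable {F C : Finset (Finset N)} {u v w : N} {a b : ℝ} (h : IsStarSubdivision F C u v w a b)

include h

theorem notMem_of_coarse {σ : Finset N} (hσ : σ ∈ C) : w ∉ σ := by
  rcases (h.mem_coarse σ).1 hσ with hσ | rfl
  · exact hσ.2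
  · simp [h.ne_left.symm, h.ne_right.symm]

theorem pair_mem : {u, v} ∈ C := (h.mem_coarse _).2 (Or.inr rfl)

theorem not_subset_of_fine {σ : Finset N} (hσ : σ ∈ F) : ¬ {u, v} ⊆ σ := by
  rcases (h.mem_fine σ).1 hσ with hσ | ⟨-, hσ | hσ⟩
  · exact hσ.2
  · intro h'
    simpa [h.ne.symm, h.ne_right] using h'.trans hσ (by simp : v ∈ _)
  · intro h'
    simpa [h.ne, h.ne_left] using h'.trans hσ (by simp : u ∈ _)

theorem starRelation_spec :
    starRelation u v w a b w = 1 ∧ starRelation u v w a b u = -a ∧ starRelation u v w a b v = -b ∧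
      (∀ x, x ≠ u → x ≠ v → x ≠ w → starRelation u v w a b x = 0) ∧
      realize (starRelation u v w a b) = 0 := by
  refine ⟨?_, ?_, ?_, fun x h1 h2 h3 => ?_, ?_⟩
  · simp [starRelation, h.ne_left.symm, h.ne_right.symm]
  · simp [starRelation, h.ne_left, h.ne]
  · simp [starRelation, h.ne_right, h.ne.symm]
  · simp [starRelation, h1, h2, h3]
  · rw [starRelation, map_sub, map_sub, realize_single, realize_single, realize_single, one_smul,
      h.eq]
    module

/-- Coordinates `f` on the subdivision give coordinates `g` on the original fan: `w` is replaced by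
`a u + b v`. As `u` and `v` do not both occur in `f`, the coefficient of `w` in `f` can be recovered
from `g` as a minimum, so `f` is determined by `g`. -/
theorem exists_coarse {f : N →₀ ℝ} (hf : IsConical F f) :
    ∃ g, IsConical C g ∧ realize g = realize f ∧
      f = g + min (g u / a) (g v / b) • starRelation u v w a b := by
  have ha := h.left_pos
  have hb := h.right_pos
  obtain ⟨hdw, hdu, hdv, hdo, hdx⟩ := h.starRelation_spec
  set d : N →₀ ℝ := starRelation u v w a b
  set g := f - f w • d with hg
  have hgw : g w = 0 := by simp [hg, hdw]
  have hgu : g u = f u + f w * a := by simp [hg, hdu]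
  have hgv : g v = f v + f w * b := by simp [hg, hdv]
  have hgo : ∀ x, x ≠ u → x ≠ v → x ≠ w → g x = f x := by
    intro x h1 h2 h3; simp [hg, hdo x h1 h2 h3]
  have hg0 : ∀ x, 0 ≤ g x := by
    intro x
    have h0 := hf.1 x
    have hw0 := hf.1 w
    rcases eq_or_ne x u with rfl | h1
    · rw [hgu]; positivity
    rcases eq_or_ne x v with rfl | h2
    · rw [hgv]; positivity
    rcases eq_or_ne x w with rfl | h3
    · rw [hgw]
    · rwa [hgo x h1 h2 h3]
  refine ⟨g, ?_, by rw [hg, map_sub, map_smul, hdx, smul_zero, sub_zero], ?_⟩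
  · by_cases hw : w ∈ f.support
    · refine isConical_of_subset h.face_coarse hg0 h.pair_mem fun x hx => ?_
      by_contra hx'
      simp only [Finset.mem_insert, Finset.mem_singleton, not_or] at hx'
      rw [Finsupp.mem_support_iff] at hx
      rcases eq_or_ne x w with rfl | h3
      · exact hx hgw
      · rw [hgo x hx'.1 hx'.2 h3, ← Finsupp.mem_support_iff] at hx
        rcases (h.mem_fine _).1 hf.2 with hσ | ⟨-, hσ | hσ⟩
        · exact h.notMem_of_coarse hσ.1 hw
        · simpa [hx'.1, h3] using hσ hx
        · simpa [hx'.2, h3] using hσ hx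
    · rw [Finsupp.notMem_support_iff] at hw
      have hgf : g = f := by rw [hg, hw, zero_smul, sub_zero]
      rw [hgf]
      exact ⟨hf.1, (h.mem_coarse _).2 (Or.inl ⟨hf.2, by simp [hw]⟩)⟩
  · have hmin : min (g u / a) (g v / b) = f w := by
      rw [hgu, hgv, add_div, add_div, mul_div_cancel_right₀ _ ha.ne', mul_div_cancel_right₀ _ hb.ne',
        min_add_add_right]
      have : min (f u / a) (f v / b) = 0 := by
        have h1 := div_nonneg (hf.1 u) ha.le
        have h2 := div_nonneg (hf.1 v) hb.le
        by_cases hu : f u = 0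
        · rw [hu, zero_div]; exact min_eq_left h2
        by_cases hv : f v = 0
        · rw [hv, zero_div]; exact min_eq_right h1
        refine absurd ?_ (h.not_subset_of_fine hf.2)
        intro x hx
        rcases Finset.mem_insert.1 hx with rfl | hx
        · simpa using hu
        · rw [Finset.mem_singleton.1 hx]; simpa using hv
      rw [this, zero_add]
    rw [hmin, hg, sub_add_cancel]

/-- Coordinates `f` on the original fan give coordinates `g` on the subdivision: the largest possible
multiple of `a u + b v` is replaced by a multiple of `w`. Hence `f` is determined by `g`. -/
theorem exists_fine {f : N →₀ ℝ} (hf : IsConical C f) :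
    ∃ g, IsConical F g ∧ realize g = realize f ∧
      f = g - g w • starRelation u v w a b := by
  have ha := h.left_pos
  have hb := h.right_pos
  obtain ⟨hdw, hdu, hdv, hdo, hdx⟩ := h.starRelation_spec
  set d : N →₀ ℝ := starRelation u v w a b
  have hfw : f w = 0 := by
    have := h.notMem_of_coarse hf.2
    simpa using this
  set m := min (f u / a) (f v / b) with hm
  have hm0 : 0 ≤ m := le_min (div_nonneg (hf.1 u) ha.le) (div_nonneg (hf.1 v) hb.le)
  set g := f + m • d with hg
  have hgw : g w = m := by simp [hg, hdw, hfw]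
  refine ⟨g, ?_, by rw [hg, map_add, map_smul, hdx, smul_zero, add_zero], ?_⟩
  · by_cases hs : {u, v} ⊆ f.support
    · have hgu : g u = f u - m * a := by simp [hg, hdu]; ring
      have hgv : g v = f v - m * b := by simp [hg, hdv]; ring
      have hfs : f.support = {u, v} := by
        rcases (h.mem_coarse _).1 hf.2 with hσ | hσ
        · exact absurd hs (h.not_subset_of_fine hσ.1)
        · exact hσ
      have hgo : ∀ x, x ≠ u → x ≠ v → x ≠ w → g x = 0 := by
        intro x h1 h2 h3
        have : f x = 0 := by
          rw [← Finsupp.notMem_support_iff, hfs]; simp [h1, h2]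
        simp [hg, hdo x h1 h2 h3, this]
      have hgu0 : 0 ≤ g u := by
        rw [hgu, sub_nonneg, ← le_div_iff₀ ha]; exact min_le_left _ _
      have hgv0 : 0 ≤ g v := by
        rw [hgv, sub_nonneg, ← le_div_iff₀ hb]; exact min_le_right _ _
      have hg0 : ∀ x, 0 ≤ g x := by
        intro x
        rcases eq_or_ne x u with rfl | h1
        · exact hgu0
        rcases eq_or_ne x v with rfl | h2
        · exact hgv0
        rcases eq_or_ne x w with rfl | h3
        · rw [hgw]; exact hm0
        · rw [hgo x h1 h2 h3]
      rcases min_choice (f u / a) (f v / b) with h1 | h1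
      · have h2 : g u = 0 := by
          rw [hgu, hm, h1, div_mul_cancel₀ _ ha.ne', sub_self]
        refine isConical_of_subset h.face_fine hg0 (σ := {v, w})
          ((h.mem_fine _).2 (Or.inr ⟨by simp, Or.inr subset_rfl⟩)) fun x hx => ?_
        by_contra hx'
        simp only [Finset.mem_insert, Finset.mem_singleton, not_or] at hx'
        rw [Finsupp.mem_support_iff] at hx
        rcases eq_or_ne x u with rfl | h3
        · exact hx h2
        · exact hx (hgo x h3 hx'.1 hx'.2)
      · have h2 : g v = 0 := by
          rw [hgv, hm, h1, div_mul_cancel₀ _ hb.ne', sub_self]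
        refine isConical_of_subset h.face_fine hg0 (σ := {u, w})
          ((h.mem_fine _).2 (Or.inr ⟨by simp, Or.inl subset_rfl⟩)) fun x hx => ?_
        by_contra hx'
        simp only [Finset.mem_insert, Finset.mem_singleton, not_or] at hx'
        rw [Finsupp.mem_support_iff] at hx
        rcases eq_or_ne x v with rfl | h3
        · exact hx h2
        · exact hx (hgo x hx'.1 h3 hx'.2)
    · have hmz : m = 0 := by
        have hs' : f u = 0 ∨ f v = 0 := by
          by_contra! hcon
          refine hs fun x hx => ?_
          rcases Finset.mem_insert.1 hx with rfl | hx
          · simpa using hcon.1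
          · rw [Finset.mem_singleton.1 hx]; simpa using hcon.2
        refine le_antisymm ?_ hm0
        rcases hs' with h0 | h0
        · exact (min_le_left _ _).trans (by rw [h0, zero_div])
        · exact (min_le_right _ _).trans (by rw [h0, zero_div])
      have hgf : g = f := by rw [hg, hmz, zero_smul, add_zero]
      rw [hgf]
      exact ⟨hf.1, (h.mem_fine _).2 (Or.inl ⟨hf.2, hs⟩)⟩
  · rw [hgw, hg, add_sub_cancel_right]

theorem unique_fine
    (hC : ∀ f g, IsConical C f → IsConical C g → realize f = realize g → f = g)
    {f g : N →₀ ℝ} (hf : IsConical F f) (hg : IsConical F g) (hx : realize f = realize g) :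
    f = g := by
  obtain ⟨f', hf', hfx, hff⟩ := h.exists_coarse hf
  obtain ⟨g', hg', hgx, hgg⟩ := h.exists_coarse hg
  obtain rfl := hC f' g' hf' hg' (by rw [hfx, hgx, hx])
  exact hff.trans hgg.symm

theorem unique_coarse
    (hF : ∀ f g, IsConical F f → IsConical F g → realize f = realize g → f = g)
    {f g : N →₀ ℝ} (hf : IsConical C f) (hg : IsConical C g) (hx : realize f = realize g) :
    f = g := by
  obtain ⟨f', hf', hfx, hff⟩ := h.exists_fine hf
  obtain ⟨g', hg', hgx, hgg⟩ := h.exists_fine hg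
  obtain rfl := hF f' g' hf' hg' (by rw [hfx, hgx, hx])
  exact hff.trans hgg.symm

end IsStarSubdivision

namespace ToricSurface

variable {X Y : ToricSurface} {u v w : N} {a b : ℝ}

theorem isComplete_iff_of_isStarSubdivision (h : IsStarSubdivision X.cones Y.cones u v w a b) :
    X.IsComplete ↔ Y.IsComplete := by
  rw [isComplete_iff, isComplete_iff]
  refine forall_congr' fun x => ⟨?_, ?_⟩
  · rintro ⟨f, hf, rfl⟩
    obtain ⟨g, hg, hx, -⟩ := h.exists_coarse hf
    exact ⟨g, hg, hx⟩
  · rintro ⟨f, hf, rfl⟩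
    obtain ⟨g, hg, hx, -⟩ := h.exists_fine hf
    exact ⟨g, hg, hx⟩

theorem rays_of_isStarSubdivision (h : IsStarSubdivision X.cones Y.cones u v w a b) :
    X.rays = insert w Y.rays := by
  ext x
  rw [Finset.mem_insert, mem_rays, mem_rays, h.mem_fine]
  constructor
  · rintro (h1 | h1)
    · exact Or.inr h1.1
    · exact Or.inl (Finset.mem_singleton.1 h1.1).symm
  · rintro (rfl | h1)
    · exact Or.inr ⟨by simp, Or.inl (by simp)⟩
    · refine Or.inl ⟨h1, fun h2 => h.ne ?_⟩
      have h3 := h2 (by simp : u ∈ _)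
      have h4 := h2 (by simp : v ∈ _)
      rw [Finset.mem_singleton] at h3 h4
      rw [h3, h4]

theorem notMem_rays_of_isStarSubdivision (h : IsStarSubdivision X.cones Y.cones u v w a b) :
    w ∉ Y.rays := fun hw => h.notMem_of_coarse (mem_rays.1 hw) (by simp)

/-- A primitive vector in the interior of a two-dimensional cone is not a ray of the fan. -/
theorem notMem_rays_of_eq (huv : u ≠ v) (hσ : {u, v} ∈ X.cones) (ha : 0 < a) (hb : 0 < b)
    (hw : toReal w = a • toReal u + b • toReal v) : w ∉ X.rays := by
  intro hwX
  have := mem_of_toReal_mem_cone hσ hwX (mem_cone_pair.2 ⟨a, b, ha.le, hb.le, hw⟩)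
  have hc : ((cross u v : ℤ) : ℝ) ≠ 0 := by exact_mod_cast cross_ne_zero hσ huv
  rcases Finset.mem_insert.1 this with rfl | h
  · have h1 : cross (toReal w) (toReal w) = b * cross (toReal w) (toReal v) := by
      nth_rw 2 [hw]
      rw [cross_add_right, cross_smul_right, cross_smul_right, cross_self, mul_zero, zero_add]
    rw [cross_self, cross_toReal] at h1
    exact (mul_ne_zero hb.ne' hc) h1.symm
  · obtain rfl := Finset.mem_singleton.1 h
    have h1 : cross (toReal w) (toReal w) = a * cross (toReal u) (toReal w) := by
      nth_rw 1 [hw]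
      rw [cross_add_left, cross_smul_left, cross_smul_left, cross_self, mul_zero, add_zero]
    rw [cross_self, cross_toReal] at h1
    exact (mul_ne_zero ha.ne' hc) h1.symm

theorem exists_starSubdivision (X : ToricSurface) (huv : u ≠ v) (hσ : {u, v} ∈ X.cones)
    (hwp : IsPrimitive w) (ha : 0 < a) (hb : 0 < b)
    (hw : toReal w = a • toReal u + b • toReal v) :
    ∃ Y : ToricSurface, IsStarSubdivision Y.cones X.cones u v w a b := by
  have hwX := notMem_rays_of_eq huv hσ ha hb hw
  have huw : u ≠ w := by rintro rfl; exact hwX (mem_rays_of_mem hσ (by simp))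
  have hvw : v ≠ w := by rintro rfl; exact hwX (mem_rays_of_mem hσ (by simp))
  set C : Finset (Finset N) := X.cones.filter (fun σ => ¬ {u, v} ⊆ σ) ∪
    (({u, w} : Finset N).powerset ∪ ({v, w} : Finset N).powerset).filter (fun σ => w ∈ σ) with hC
  have hmem : ∀ σ, σ ∈ C ↔
      (σ ∈ X.cones ∧ ¬ {u, v} ⊆ σ) ∨ (w ∈ σ ∧ (σ ⊆ {u, w} ∨ σ ⊆ {v, w})) := by
    intro σ
    simp only [hC, Finset.mem_union, Finset.mem_filter, Finset.mem_powerset]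
    tauto
  have hface : ∀ σ ∈ C, ∀ τ, τ ⊆ σ → τ ∈ C := by
    intro σ hσC τ hτ
    rw [hmem] at hσC ⊢
    rcases hσC with h | h
    · exact Or.inl ⟨X.face_mem σ h.1 τ hτ, fun h' => h.2 (h'.trans hτ)⟩
    · by_cases hwτ : w ∈ τ
      · exact Or.inr ⟨hwτ, h.2.imp hτ.trans hτ.trans⟩
      · refine Or.inl ?_
        rcases h.2 with h | h
        · have h1 : τ ⊆ {u} := by
            intro x hx
            have := h (hτ hx)
            simp only [Finset.mem_insert, Finset.mem_singleton] at this ⊢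
            rcases this with h | rfl
            · exact h
            · exact absurd hx hwτ
          refine ⟨X.face_mem _ hσ _ (h1.trans (by simp)), fun h' => huv ?_⟩
          have := Finset.mem_singleton.1 (h1 (h' (by simp : v ∈ _)))
          exact this.symm
        · have h1 : τ ⊆ {v} := by
            intro x hx
            have := h (hτ hx)
            simp only [Finset.mem_insert, Finset.mem_singleton] at this ⊢
            rcases this with h | rfl
            · exact h
            · exact absurd hx hwτ
          refine ⟨X.face_mem _ hσ _ (h1.trans (by simp)), fun h' => huv ?_⟩
          exact Finset.mem_singleton.1 (h1 (h' (by simp : u ∈ _)))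
  have hwσ : ∀ σ ∈ X.cones, w ∉ σ := fun σ h h' => hwX (mem_rays_of_mem h h')
  have hsub : IsStarSubdivision C X.cones u v w a b := by
    refine ⟨huv, huw, hvw, ha, hb, hw, hmem, fun σ => ⟨fun h => ?_, ?_⟩, hface, X.face_mem⟩
    · by_cases h' : {u, v} ⊆ σ
      · refine Or.inr (Finset.eq_of_subset_of_card_le h' ?_).symm
        rw [Finset.card_pair huv]
        exact card_le_two h
      · exact Or.inl ⟨(hmem _).2 (Or.inl ⟨h, h'⟩), hwσ σ h⟩
    · rintro (⟨h, h'⟩ | rfl)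
      · rcases (hmem _).1 h with h | h
        · exact h.1
        · exact absurd h.1 h'
      · exact hσ
  refine ⟨ofUnique C ?_ ?_ hface
    (fun f g hf hg hx => hsub.unique_fine (fun _ _ => eq_of_realize_eq) hf hg hx), hsub⟩
  · exact (hmem _).2 (Or.inl ⟨X.zero_mem, by simp⟩)
  · intro σ hσC x hx
    rcases (hmem _).1 hσC with h | ⟨-, h⟩
    · exact X.primitive σ h.1 x hx
    · have hu := X.primitive _ hσ u (by simp)
      have hv := X.primitive _ hσ v (by simp)
      rcases h with h | h
      · rcases Finset.mem_insert.1 (h hx) with rfl | h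
        · exact hu
        · rwa [Finset.mem_singleton.1 h]
      · rcases Finset.mem_insert.1 (h hx) with rfl | h
        · exact hv
        · rwa [Finset.mem_singleton.1 h]

/-- A ray that lies between its two neighbours can be removed from a fan. -/
theorem exists_isStarSubdivision_of_neighbours (X : ToricSurface) (huv : u ≠ v) (huw : u ≠ w)
    (hvw : v ≠ w) (hu : {u, w} ∈ X.cones) (hv : {v, w} ∈ X.cones)
    (hn : ∀ x, x ≠ w → {w, x} ∈ X.cones → x = u ∨ x = v) (ha : 0 < a) (hb : 0 < b)
    (hw : toReal w = a • toReal u + b • toReal v) :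
    ∃ Y : ToricSurface, IsStarSubdivision X.cones Y.cones u v w a b := by
  have huvX : ∀ σ ∈ X.cones, ¬ {u, v} ⊆ σ := by
    intro σ hσ h
    exact notMem_rays_of_eq huv (X.face_mem σ hσ _ h) ha hb hw (mem_rays_of_mem hu (by simp))
  have hstar : ∀ σ ∈ X.cones, w ∈ σ → σ ⊆ {u, w} ∨ σ ⊆ {v, w} := by
    intro σ hσ hwσ
    rcases eq_singleton_or_pair hσ hwσ with rfl | ⟨x, hx, rfl⟩
    · exact Or.inl (by simp)
    · rcases hn x hx hσ with rfl | rfl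
      · exact Or.inl (by rw [Finset.pair_comm])
      · exact Or.inr (by rw [Finset.pair_comm])
  set C : Finset (Finset N) := insert {u, v} (X.cones.filter (fun σ => w ∉ σ)) with hC
  have hmem : ∀ σ, σ ∈ C ↔ (σ ∈ X.cones ∧ w ∉ σ) ∨ σ = {u, v} := by
    intro σ
    simp only [hC, Finset.mem_insert, Finset.mem_filter]
    tauto
  have huX : {u} ∈ X.cones := X.face_mem _ hu _ (by simp)
  have hvX : {v} ∈ X.cones := X.face_mem _ hv _ (by simp)
  have hpair : ∀ τ, τ ⊆ {u, v} → ¬ {u, v} ⊆ τ → τ ∈ X.cones ∧ w ∉ τ := by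
    intro τ hτ hn
    refine ⟨?_, fun h => by simpa [huw.symm, hvw.symm] using hτ h⟩
    by_cases h1 : u ∈ τ
    · refine X.face_mem _ huX _ fun x hx => ?_
      have := hτ hx
      simp only [Finset.mem_insert, Finset.mem_singleton] at this ⊢
      rcases this with h | rfl
      · exact h
      · exact absurd (Finset.insert_subset h1 (by simpa using hx)) hn
    · refine X.face_mem _ hvX _ fun x hx => ?_
      have := hτ hx
      simp only [Finset.mem_insert, Finset.mem_singleton] at this ⊢
      rcases this with rfl | h
      · exact absurd hx h1
      · exact h
  have hface : ∀ σ ∈ C, ∀ τ, τ ⊆ σ → τ ∈ C := by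
    intro σ hσC τ hτ
    rw [hmem] at hσC ⊢
    rcases hσC with h | rfl
    · exact Or.inl ⟨X.face_mem σ h.1 τ hτ, fun h' => h.2 (hτ h')⟩
    · by_cases h : {u, v} ⊆ τ
      · exact Or.inr (hτ.antisymm h)
      · exact Or.inl (hpair τ hτ h)
  have hsub : IsStarSubdivision X.cones C u v w a b := by
    refine ⟨huv, huw, hvw, ha, hb, hw, fun σ => ⟨fun h => ?_, ?_⟩, hmem, X.face_mem, hface⟩
    · by_cases h' : w ∈ σ
      · exact Or.inr ⟨h', hstar σ h h'⟩
      · exact Or.inl ⟨(hmem _).2 (Or.inl ⟨h, h'⟩), huvX σ h⟩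
    · rintro (⟨h, h'⟩ | ⟨-, h | h⟩)
      · rcases (hmem _).1 h with h | rfl
        · exact h.1
        · exact absurd subset_rfl h'
      · exact X.face_mem _ hu _ h
      · exact X.face_mem _ hv _ h
  refine ⟨ofUnique C ?_ ?_ hface
    (fun f g hf hg hx => hsub.unique_coarse (fun _ _ => eq_of_realize_eq) hf hg hx), hsub⟩
  · exact (hmem _).2 (Or.inl ⟨X.zero_mem, by simp⟩)
  · intro σ hσC x hx
    rcases (hmem _).1 hσC with h | rfl
    · exact X.primitive σ h.1 x hx
    · rcases Finset.mem_insert.1 hx with rfl | h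
      · exact X.primitive _ huX _ (by simp)
      · rw [Finset.mem_singleton.1 h]
        exact X.primitive _ hvX _ (by simp)

end ToricSurface

/-! ### The minimal resolution -/

namespace ToricSurface

variable {X Y Z S : ToricSurface} {u v w : N} {a b : ℝ}

/-- The fan of `X` refines the fan of `Y`: every cone of `X` lies in a cone of `Y`. -/
def Refines (X Y : ToricSurface) : Prop :=
  ∀ σ ∈ X.cones, ∃ τ ∈ Y.cones, ∀ v ∈ σ, toReal v ∈ cone τ

theorem Refines.refl (X : ToricSurface) : X.Refines X :=
  fun σ hσ => ⟨σ, hσ, fun _ => toReal_mem_cone⟩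

theorem Refines.trans (h : X.Refines Y) (h' : Y.Refines Z) : X.Refines Z := by
  intro σ hσ
  obtain ⟨τ, hτ, h1⟩ := h σ hσ
  obtain ⟨ρ, hρ, h2⟩ := h' τ hτ
  exact ⟨ρ, hρ, fun v hv => cone_le h2 (h1 v hv)⟩

theorem refines_of_isStarSubdivision (h : IsStarSubdivision X.cones Y.cones u v w a b) :
    X.Refines Y := by
  intro σ hσ
  rcases (h.mem_fine σ).1 hσ with hσ | ⟨-, hσ⟩
  · exact ⟨σ, hσ.1, fun _ => toReal_mem_cone⟩
  · refine ⟨_, h.pair_mem, fun x hx => ?_⟩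
    have hw : toReal w ∈ cone {u, v} :=
      mem_cone_pair.2 ⟨a, b, h.left_pos.le, h.right_pos.le, h.eq⟩
    have hx' : x = u ∨ x = v ∨ x = w := by
      rcases hσ with hσ | hσ <;> have := hσ hx <;> simp at this <;> tauto
    rcases hx' with rfl | rfl | rfl
    · exact toReal_mem_cone (by simp)
    · exact toReal_mem_cone (by simp)
    · exact hw

/-- The sum of the squares of the indices of the two-dimensional cones, each counted twice. It
drops under the star subdivisions that resolve the singularities. -/
def totalIndex (X : ToricSurface) : ℕ :=
  ∑ σ ∈ X.cones, ∑ u ∈ σ, ∑ v ∈ σ, (cross u v).natAbs ^ 2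

theorem sum_pair_cross_sq (h : u ≠ v) :
    (∑ x ∈ ({u, v} : Finset N), ∑ y ∈ ({u, v} : Finset N), (cross x y).natAbs ^ 2) =
      2 * (cross u v).natAbs ^ 2 := by
  rw [Finset.sum_pair h, Finset.sum_pair h, Finset.sum_pair h, cross_self, cross_self,
    cross_swap v u, Int.natAbs_neg]
  simp
  ring

theorem totalIndex_lt (h : IsStarSubdivision X.cones Y.cones u v w a b)
    (hlt : (cross u w).natAbs ^ 2 + (cross v w).natAbs ^ 2 < (cross u v).natAbs ^ 2) :
    X.totalIndex < Y.totalIndex := by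
  have hX : X.cones = insert {w} (insert {u, w} (insert {v, w} (Y.cones.erase {u, v}))) := by
    ext σ
    simp only [Finset.mem_insert, Finset.mem_erase]
    constructor
    · intro hσ
      by_cases hw : w ∈ σ
      · rcases eq_singleton_or_pair hσ hw with rfl | ⟨x, hx, rfl⟩
        · exact Or.inl rfl
        · rcases (h.mem_fine _).1 hσ with h1 | ⟨-, h1 | h1⟩
          · exact absurd hw (h.notMem_of_coarse h1.1)
          · have := h1 (by simp : x ∈ _)
            simp only [Finset.mem_insert, Finset.mem_singleton, hx, or_false] at this
            rw [this, Finset.pair_comm]; simp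
          · have := h1 (by simp : x ∈ _)
            simp only [Finset.mem_insert, Finset.mem_singleton, hx, or_false] at this
            rw [this, Finset.pair_comm]; simp
      · refine Or.inr (Or.inr (Or.inr ⟨?_, (h.mem_coarse σ).2 (Or.inl ⟨hσ, hw⟩)⟩))
        rintro rfl
        exact h.not_subset_of_fine hσ subset_rfl
    · rintro (rfl | rfl | rfl | ⟨h1, h2⟩)
      · exact (h.mem_fine _).2 (Or.inr ⟨by simp, Or.inl (by simp)⟩)
      · exact (h.mem_fine _).2 (Or.inr ⟨by simp, Or.inl subset_rfl⟩)
      · exact (h.mem_fine _).2 (Or.inr ⟨by simp, Or.inr subset_rfl⟩)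
      · rcases (h.mem_coarse _).1 h2 with h3 | h3
        · exact h3.1
        · exact absurd h3 h1
  have hne : ∀ σ ∈ Y.cones, w ∉ σ := fun σ hσ => h.notMem_of_coarse hσ
  have hne' : ∀ σ, w ∈ σ → σ ∉ Y.cones.erase {u, v} :=
    fun σ hw hσ => hne σ (Finset.mem_of_mem_erase hσ) hw
  have h1 : ({u, w} : Finset N) ≠ {v, w} := by
    intro h'
    have : u ∈ ({v, w} : Finset N) := by rw [← h']; simp
    simp [h.ne, h.ne_left] at this
  have h2 : ({w} : Finset N) ≠ {v, w} := by
    intro h'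
    have : v ∈ ({w} : Finset N) := by rw [h']; simp
    simp [h.ne_right] at this
  have h3 : ({w} : Finset N) ≠ {u, w} := by
    intro h'
    have : u ∈ ({w} : Finset N) := by rw [h']; simp
    simp [h.ne_left] at this
  rw [totalIndex, totalIndex, hX,
    Finset.sum_insert (by simp only [Finset.mem_insert, not_or]; exact ⟨h3, h2, hne' _ (by simp)⟩),
    Finset.sum_insert (by simp only [Finset.mem_insert, not_or]; exact ⟨h1, hne' _ (by simp)⟩),
    Finset.sum_insert (hne' _ (by simp)), sum_pair_cross_sq h.ne_left, sum_pair_cross_sq h.ne_right,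
    ← Finset.add_sum_erase _ _ h.pair_mem, sum_pair_cross_sq h.ne]
  simp only [Finset.sum_singleton, cross_self, Int.natAbs_zero]
  omega

/-- A two-dimensional cone of index `d > 1` can be subdivided along a primitive vector `w` into a
smooth cone and a cone of smaller index. -/
theorem exists_primitive_between (hu : IsPrimitive u) (hv : IsPrimitive v) (hd : 1 < cross u v) :
    ∃ w, cross u w = 1 ∧ 0 < cross w v ∧ cross w v < cross u v := by
  obtain ⟨w₀, hw₀⟩ := hu.exists_cross_eq_one
  -- adding multiples of `u` to `w₀` reduces `cross w₀ v` modulo `cross u v`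
  set w := w₀ + (-(cross w₀ v / cross u v)) • u with hw
  have h1 : cross u w = 1 := by rw [hw, cross_add_right, cross_smul_right, cross_self, hw₀]; ring
  have h2 : cross w v = cross w₀ v % cross u v := by
    rw [hw, cross_add_left, cross_smul_left, Int.emod_def]; ring
  refine ⟨w, h1, lt_of_le_of_ne ?_ ?_, ?_⟩
  · rw [h2]; exact Int.emod_nonneg _ (by omega)
  · intro h0
    obtain ⟨k, hk⟩ := hv.eq_zsmul_of_cross_eq_zero (w := w) (by rw [cross_swap, ← h0, neg_zero])
    rw [hk, cross_smul_right] at h1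
    have := Int.eq_one_or_neg_one_of_mul_eq_one' h1
    omega
  · rw [h2]; exact Int.emod_lt_of_pos _ (by omega)

theorem exists_isSmooth_refines (hS : S.IsComplete) :
    ∃ X : ToricSurface, X.IsComplete ∧ X.IsSmooth ∧ X.Refines S ∧ S.rays ⊆ X.rays := by
  induction h : S.totalIndex using Nat.strong_induction_on generalizing S with
  | _ n ih =>
    by_cases hs : S.IsSmooth
    · exact ⟨S, hS, hs, Refines.refl S, subset_rfl⟩
    have : ∃ u v, u ≠ v ∧ {u, v} ∈ S.cones ∧ 1 < cross u v := by
      rw [isSmooth_iff] at hs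
      push Not at hs
      obtain ⟨u, v, huv, hσ, hc⟩ := hs
      have h0 := cross_ne_zero hσ huv
      rw [Int.isUnit_iff, not_or] at hc
      rcases lt_or_gt_of_ne h0 with h0 | h0
      · exact ⟨v, u, huv.symm, by rwa [Finset.pair_comm], by rw [cross_swap]; omega⟩
      · exact ⟨u, v, huv, hσ, by omega⟩
    obtain ⟨u, v, huv, hσ, hd⟩ := this
    obtain ⟨w, h1, h2, h3⟩ := exists_primitive_between (S.primitive _ hσ u (by simp))
      (S.primitive _ hσ v (by simp)) hd
    have hwp : IsPrimitive w :=
      isPrimitive_of_cross_eq_one (w := -u) (by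
        rw [← neg_one_smul ℤ u, cross_smul_right, cross_swap, h1]; rfl)
    have hd' : (0 : ℝ) < (cross u v : ℤ) := by exact_mod_cast (by omega : 0 < cross u v)
    have h2' : (0 : ℝ) < (cross w v : ℤ) := by exact_mod_cast h2
    have hw : toReal w = (((cross w v : ℤ) : ℝ) / (cross u v : ℤ)) • toReal u +
        (1 / ((cross u v : ℤ) : ℝ)) • toReal v := by
      have := cross_smul_eq (toReal u) (toReal v) (toReal w)
      simp only [cross_toReal, h1, Int.cast_one] at this
      rw [div_eq_inv_mul, div_eq_inv_mul, mul_smul, mul_smul, ← smul_add, ← this, smul_smul,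
        inv_mul_cancel₀ hd'.ne', one_smul]
    obtain ⟨Y, hY⟩ := exists_starSubdivision S huv hσ hwp (div_pos h2' hd') (one_div_pos.2 hd') hw
    have hlt : Y.totalIndex < S.totalIndex := by
      refine totalIndex_lt hY ?_
      rw [h1, cross_swap v w, Int.natAbs_neg]
      zify
      simp only [sq_abs]
      nlinarith
    obtain ⟨X, hX1, hX2, hX3, hX4⟩ := ih _ (h ▸ hlt)
      ((isComplete_iff_of_isStarSubdivision hY).2 hS) rfl
    refine ⟨X, hX1, hX2, hX3.trans (refines_of_isStarSubdivision hY), subset_trans ?_ hX4⟩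
    rw [rays_of_isStarSubdivision hY]
    exact Finset.subset_insert _ _

/-- A cone of `S` that contains a ray of a refinement `X` which is not a ray of `S` contains all
cones of `X` around that ray. -/
theorem Refines.mem_cone (h : X.Refines S) (hv : v ∉ S.rays) {ρ τ : Finset N} (hρ : ρ ∈ X.cones)
    (hvρ : v ∈ ρ) (hτ : τ ∈ S.cones) (hvτ : toReal v ∈ cone τ) : ∀ r ∈ ρ, toReal r ∈ cone τ := by
  obtain ⟨τ', hτ', hρτ'⟩ := h ρ hρ
  obtain ⟨f, hf, hfs, hfx⟩ := mem_cone_iff.1 hvτ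
  obtain ⟨g, hg, hgs, hgx⟩ := mem_cone_iff.1 (hρτ' v hvρ)
  obtain rfl := eq_of_realize_eq (isConical hf hτ hfs) (isConical hg hτ' hgs) (hfx.trans hgx.symm)
  have hvp := X.primitive ρ hρ v hvρ
  -- `v` lies in the interior of a two-dimensional cone, as it is not on a ray of `S`
  have hcard : 2 ≤ f.support.card := by
    by_contra! hlt
    obtain ⟨r, hr⟩ := Finset.card_le_one_iff_subset_singleton.1 (Nat.lt_succ_iff.1 hlt)
    rw [realize_eq_sum hr, Finset.sum_singleton] at hfx
    by_cases hrs : r ∈ f.support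
    · have hrS := mem_rays_of_mem hτ (hfs hrs)
      have := IsPrimitive.eq_of_toReal_eq_smul (isPrimitive hrS) hvp (hf r) hfx.symm
      exact hv (this ▸ hrS)
    · rw [Finsupp.notMem_support_iff.1 hrs, zero_smul, ← toReal_zero] at hfx
      exact hvp.ne_zero (toReal_injective hfx).symm
  have h1 : f.support = τ := Finset.eq_of_subset_of_card_le hfs ((card_le_two hτ).trans hcard)
  have h2 : f.support = τ' := Finset.eq_of_subset_of_card_le hgs ((card_le_two hτ').trans hcard)
  rw [← h1, h2]
  exact hρτ'

/-- Every `(-1)`-curve on a smooth complete toric surface can be contracted to a smooth point. -/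
theorem exists_contraction (hX : X.IsComplete) (hs : X.IsSmooth) (hv : X.IsMinusOneCurve v) :
    ∃ (Y : ToricSurface) (p q : N), IsStarSubdivision X.cones Y.cones p q v 1 1 ∧ p + q = v ∧
      Y.IsComplete ∧ Y.IsSmooth := by
  obtain ⟨p, q, b, hp, hq, hpq, hpc, hqc, hb, hfil, hc⟩ :=
    exists_neighbours_of_isSmooth hX hs hv.1
  have hb1 : b = 1 := by have := (hc _).1 hv.2; omega
  rw [hb1, one_smul] at hb
  obtain ⟨Y, hY⟩ := exists_isStarSubdivision_of_neighbours X (u := p) (v := q) (w := v) (a := 1)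
    (b := 1) hpq hp hq hpc hqc (fun x hx hxc => by
      have : x ∈ X.rays.filter (fun u => u ≠ v ∧ {u, v} ∈ X.cones) :=
        Finset.mem_filter.2 ⟨mem_rays_of_mem hxc (by simp), hx, by rwa [Finset.pair_comm]⟩
      rw [hfil] at this
      simpa using this) one_pos one_pos (by rw [← hb, toReal_add, one_smul, one_smul])
  refine ⟨Y, p, q, hY, hb, (isComplete_iff_of_isStarSubdivision hY).1 hX, ?_⟩
  rw [isSmooth_iff] at hs ⊢
  intro x y hxy hσ
  rcases (hY.mem_coarse _).1 hσ with h | h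
  · exact hs x y hxy h.1
  · have h1 : IsUnit (cross p q) := by
      have := hs p v hp hpc
      rwa [← hb, cross_add_right, cross_self, zero_add] at this
    have hx : x ∈ ({p, q} : Finset N) := by rw [← h]; simp
    have hy : y ∈ ({p, q} : Finset N) := by rw [← h]; simp
    simp only [Finset.mem_insert, Finset.mem_singleton] at hx hy
    rcases hx with rfl | rfl <;> rcases hy with rfl | rfl
    · exact absurd rfl hxy
    · exact h1
    · rw [cross_swap]; exact h1.neg
    · exact absurd rfl hxy

/-- The fan of `X` is the fan of the minimal resolution of the complete toric surface `S`: a smooth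
refinement of the fan of `S` in which the additional rays are not `(-1)`-curves. -/
structure IsMinimalRefinement (X S : ToricSurface) : Prop where
  complete : X.IsComplete
  smooth : X.IsSmooth
  refines : X.Refines S
  rays_subset : S.rays ⊆ X.rays
  not_minusOne : ∀ v, v ∉ S.rays → ¬ X.IsMinusOneCurve v

theorem exists_isMinimalRefinement (hS : S.IsComplete) :
    ∃ X : ToricSurface, X.IsMinimalRefinement S := by
  obtain ⟨X, hX, hs, hr, hsub⟩ := exists_isSmooth_refines hS
  induction h : X.rays.card using Nat.strong_induction_on generalizing X with
  | _ n ih =>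
    by_cases hm : ∀ v, v ∉ S.rays → ¬ X.IsMinusOneCurve v
    · exact ⟨X, hX, hs, hr, hsub, hm⟩
    push Not at hm
    obtain ⟨v, hvS, hv⟩ := hm
    obtain ⟨Y, p, q, hY, hpq, hYc, hYs⟩ := exists_contraction hX hs hv
    have hrays := rays_of_isStarSubdivision hY
    have hvY := notMem_rays_of_isStarSubdivision hY
    refine ih Y.rays.card ?_ Y hYc hYs ?_ ?_ rfl
    · rw [← h, hrays, Finset.card_insert_of_notMem hvY]
      exact Nat.lt_succ_self _
    · intro σ hσ
      rcases (hY.mem_coarse σ).1 hσ with h1 | rfl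
      · exact hr σ h1.1
      · have hpv : {p, v} ∈ X.cones := (hY.mem_fine _).2 (Or.inr ⟨by simp, Or.inl subset_rfl⟩)
        have hqv : {q, v} ∈ X.cones := (hY.mem_fine _).2 (Or.inr ⟨by simp, Or.inr subset_rfl⟩)
        obtain ⟨τ, hτ, hτ'⟩ := hr _ hpv
        refine ⟨τ, hτ, fun x hx => ?_⟩
        rcases Finset.mem_insert.1 hx with rfl | hx
        · exact hτ' _ (by simp)
        · rw [Finset.mem_singleton.1 hx]
          exact hr.mem_cone hvS hqv (by simp) hτ (hτ' v (by simp)) q (by simp)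
    · intro x hx
      have := hsub hx
      rw [hrays, Finset.mem_insert] at this
      rcases this with rfl | h1
      · exact absurd hx hvS
      · exact h1

/-- The exceptional curves of the minimal resolution have self-intersection at most `-2`. -/
theorem IsMinimalRefinement.two_le (h : X.IsMinimalRefinement S) (hv : v ∈ X.rays)
    (hvS : v ∉ S.rays) {p q : N} {b : ℤ} (hp : {p, v} ∈ X.cones) (hq : {q, v} ∈ X.cones)
    (hpq : p + q = b • v) (hb : ∀ c, X.HasSelfIntersection v c ↔ c = -b) : 2 ≤ b := by
  by_contra! hlt
  have hb1 : b ≠ 1 := by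
    rintro rfl
    exact h.not_minusOne v hvS ⟨hv, (hb _).2 rfl⟩
  have hb0 : (0 : ℝ) ≤ -(b : ℝ) := by
    have : b ≤ 0 := by omega
    have : (b : ℝ) ≤ 0 := by exact_mod_cast this
    linarith
  obtain ⟨τ, hτ, hpτ⟩ := h.refines _ hp
  have hvτ := hpτ v (by simp)
  obtain ⟨f, hf, hfs, hfx⟩ := mem_cone_iff.1 (hpτ p (by simp))
  obtain ⟨g, hg, hgs, hgx⟩ :=
    mem_cone_iff.1 (h.refines.mem_cone hvS hq (by simp) hτ hvτ q (by simp))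
  obtain ⟨k, hk, hks, hkx⟩ := mem_cone_iff.1 hvτ
  -- for `b ≤ 0` the relation `p + q - b v = 0` contradicts the strong convexity of `cone τ`
  have h0 : f + g + (-(b : ℝ)) • k = 0 := by
    refine S.eq_of_realize_eq_of_support_subset hτ (Finsupp.support_add.trans (Finset.union_subset
      (Finsupp.support_add.trans (Finset.union_subset hfs hgs))
      (Finsupp.support_smul.trans hks))) (by simp) ?_
    rw [map_add, map_add, map_smul, hfx, hgx, hkx, ← toReal_add, hpq, toReal_zsmul, map_zero]
    module
  have hf0 : f = 0 := by
    ext x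
    have h1 := DFunLike.congr_fun h0 x
    simp only [Finsupp.add_apply, Finsupp.smul_apply, smul_eq_mul, Finsupp.zero_apply] at h1
    have h2 := mul_nonneg hb0 (hk x)
    have h3 := hf x
    have h4 := hg x
    rw [Finsupp.zero_apply]
    linarith
  rw [hf0, map_zero, ← toReal_zero] at hfx
  exact (X.primitive _ hp p (by simp)).ne_zero (toReal_injective hfx).symm

/-- In the minimal resolution of a cone with edges `e` and `u`, the rays other than `e` have
`e`-coordinate less than one. Otherwise let `v` be the ray whose pair of coordinates is
lexicographically maximal. It is exceptional, so its two neighbours, which are lexicographically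
smaller, add up to a multiple `b v` with `b ≥ 2`, which is absurd. -/
theorem IsMinimalRefinement.coord_lt_one (h : X.IsMinimalRefinement S) {e : N} (heu : e ≠ u)
    (hτ : {e, u} ∈ S.cones) (hw : w ∈ X.rays) (hwe : w ≠ e) (ha : 0 ≤ a) (hb : 0 ≤ b)
    (hw' : toReal w = a • toReal e + b • toReal u) : a < 1 := by
  have hD : ((cross e u : ℤ) : ℝ) ≠ 0 := by exact_mod_cast cross_ne_zero hτ heu
  set α : N → ℝ := fun r => (cross r u : ℤ) / (cross e u : ℤ) with hα
  set β : N → ℝ := fun r => (cross e r : ℤ) / (cross e u : ℤ) with hβ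
  have hcoord : ∀ r (x y : ℝ), toReal r = x • toReal e + y • toReal u → α r = x ∧ β r = y := by
    intro r x y hr
    have h1 : ((cross r u : ℤ) : ℝ) = x * (cross e u : ℤ) := by
      rw [← cross_toReal, hr, cross_add_left, cross_smul_left, cross_smul_left, cross_self,
        cross_toReal, mul_zero, add_zero]
    have h2 : ((cross e r : ℤ) : ℝ) = y * (cross e u : ℤ) := by
      rw [← cross_toReal, hr, cross_add_right, cross_smul_right, cross_smul_right, cross_self,
        cross_toReal, mul_zero, zero_add]
    simp only [hα, hβ, h1, h2]
    exact ⟨mul_div_cancel_right₀ _ hD, mul_div_cancel_right₀ _ hD⟩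
  have hext : ∀ r s, α r = α s → β r = β s → r = s := by
    intro r s h1 h2
    simp only [hα, hβ, div_left_inj' hD, Int.cast_inj] at h1 h2
    have h3 := cross_smul_eq e u r
    rw [h1, h2, ← cross_smul_eq e u s] at h3
    exact smul_right_injective N (cross_ne_zero hτ heu) h3
  by_contra! ha1
  classical
  set R := X.rays.filter (fun r => toReal r ∈ cone {e, u}) with hR
  have hwR : w ∈ R := Finset.mem_filter.2 ⟨hw, mem_cone_pair.2 ⟨a, b, ha, hb, hw'⟩⟩
  obtain ⟨v, hvR, hmax⟩ := R.exists_max_image (fun r => toLex (α r, β r)) ⟨w, hwR⟩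
  simp only [Prod.Lex.toLex_le_toLex] at hmax
  obtain ⟨hvX, hvτ⟩ := Finset.mem_filter.1 hvR
  obtain ⟨hαw, hβw⟩ := hcoord w a b hw'
  obtain ⟨hαe, hβe⟩ := hcoord e 1 0 (by simp)
  obtain ⟨hαu, hβu⟩ := hcoord u 0 1 (by simp)
  have hαv : 1 ≤ α v := by
    rcases hmax w hwR with h1 | h1 <;> linarith
  have hve : v ≠ e := by
    rintro rfl
    rcases hmax w hwR with h1 | h1
    · linarith
    · exact hwe (hext _ _ h1.1 (by linarith))
  have hvu : v ≠ u := by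
    rintro rfl
    linarith
  have hvS : v ∉ S.rays := fun hvS => by
    have := mem_of_toReal_mem_cone hτ hvS hvτ
    simp [hve, hvu] at this
  obtain ⟨p, q, c, hp, hq, -, hpc, hqc, hpq, -, hc⟩ :=
    exists_neighbours_of_isSmooth h.complete h.smooth hvX
  have hc2 : (2 : ℝ) ≤ c := by exact_mod_cast h.two_le hvX hvS hpc hqc hpq hc
  have hpR : p ∈ R := Finset.mem_filter.2 ⟨mem_rays_of_mem hpc (by simp),
    h.refines.mem_cone hvS hpc (by simp) hτ hvτ p (by simp)⟩
  have hqR : q ∈ R := Finset.mem_filter.2 ⟨mem_rays_of_mem hqc (by simp),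
    h.refines.mem_cone hvS hqc (by simp) hτ hvτ q (by simp)⟩
  have hα2 : α p + α q = c * α v := by
    simp only [hα]
    rw [← add_div, mul_div_assoc', ← Int.cast_add, ← cross_add_left, hpq, cross_smul_left]
    push_cast; rfl
  have hβ2 : β p + β q = c * β v := by
    simp only [hβ]
    rw [← add_div, mul_div_assoc', ← Int.cast_add, ← cross_add_right, hpq, cross_smul_right]
    push_cast; rfl
  have hmp := hmax p hpR
  have hmq := hmax q hqR
  have hc3 : 2 * α v ≤ c * α v := mul_le_mul_of_nonneg_right hc2 (by linarith)
  have hpα : α p = α v := by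
    rcases hmp with h1 | h1 <;> rcases hmq with h2 | h2 <;> linarith
  have hqα : α q = α v := by
    rcases hmp with h1 | h1 <;> rcases hmq with h2 | h2 <;> linarith
  have hc4 : (c : ℝ) = 2 := by
    have : (c - 2) * α v = 0 := by linarith
    rcases mul_eq_zero.1 this with h1 | h1 <;> linarith
  rw [hc4] at hβ2
  refine hp (hext _ _ hpα ?_)
  have h1 : β p ≤ β v := by rcases hmp with h1 | h1 <;> linarith
  have h2 : β q ≤ β v := by rcases hmq with h1 | h1 <;> linarith
  linarith

end ToricSurface

/-! ### Contraction of a (-1)-curve next to a curve of self-intersection at most -3 -/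

theorem IsStarSubdivision.symm {F C : Finset (Finset N)} {u v w : N} {a b : ℝ}
    (h : IsStarSubdivision F C u v w a b) : IsStarSubdivision F C v u w b a where
  ne := h.ne.symm
  ne_left := h.ne_right
  ne_right := h.ne_left
  left_pos := h.right_pos
  right_pos := h.left_pos
  eq := by rw [h.eq, add_comm]
  mem_fine σ := by rw [h.mem_fine, Finset.pair_comm v u, or_comm (a := σ ⊆ {u, w})]
  mem_coarse σ := by rw [h.mem_coarse, Finset.pair_comm v u]
  face_fine := h.face_fine
  face_coarse := h.face_coarse

namespace ToricSurface

variable {X Y S : ToricSurface} {u v w e : N} {a b : ℝ}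

/-- A neighbour in a refinement of a ray `e` of `S` lies in a two-dimensional cone of `S` with
edge `e`. -/
theorem Refines.exists_edge (h : X.Refines S) (he : e ∈ S.rays) (hw : {w, e} ∈ X.cones)
    (hwe : w ≠ e) : ∃ (u : N) (a b : ℝ), e ≠ u ∧ {e, u} ∈ S.cones ∧ 0 ≤ a ∧ 0 < b ∧
      toReal w = a • toReal e + b • toReal u := by
  have hwp := X.primitive _ hw w (by simp)
  have hep := X.primitive _ hw e (by simp)
  obtain ⟨τ, hτ, hwτ⟩ := h _ hw
  have heτ := mem_of_toReal_mem_cone hτ he (hwτ e (by simp))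
  have hw' := hwτ w (by simp)
  rcases eq_singleton_or_pair hτ heτ with rfl | ⟨u, hu, rfl⟩
  · rw [← Finset.pair_eq_singleton] at hw'
    obtain ⟨a, b, ha, hb, hab⟩ := mem_cone_pair.1 hw'
    rw [← add_smul] at hab
    exact absurd (hep.eq_of_toReal_eq_smul hwp (by positivity) hab) hwe
  · obtain ⟨a, b, ha, hb, hab⟩ := mem_cone_pair.1 hw'
    refine ⟨u, a, b, hu.symm, hτ, ha, lt_of_le_of_ne hb ?_, hab⟩
    rintro rfl
    rw [zero_smul, add_zero] at hab
    exact hwe (hep.eq_of_toReal_eq_smul hwp ha hab)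

theorem pair_mem_coarse_iff
    (h : IsStarSubdivision X.cones Y.cones u v w a b) {x y : N} (hyu : y ≠ u) (hyv : y ≠ v)
    (hyw : y ≠ w) : {x, y} ∈ Y.cones ↔ {x, y} ∈ X.cones := by
  rw [h.mem_coarse]
  constructor
  · rintro (h1 | h1)
    · exact h1.1
    · have : y ∈ ({u, v} : Finset N) := by rw [← h1]; simp
      simp [hyu, hyv] at this
  · refine fun h1 => Or.inl ⟨h1, fun hw => ?_⟩
    rcases (h.mem_fine _).1 h1 with h2 | ⟨-, h2 | h2⟩
    · exact h.notMem_of_coarse h2.1 hw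
    · simpa [hyu, hyw] using h2 (by simp : y ∈ _)
    · simpa [hyv, hyw] using h2 (by simp : y ∈ _)

/-- Contracting a curve does not change the self-intersection of curves that do not meet it. -/
theorem hasSelfIntersection_iff_of_isStarSubdivision
    (h : IsStarSubdivision X.cones Y.cones u v w a b) {y : N} (hyu : y ≠ u) (hyv : y ≠ v)
    (hyw : y ≠ w) (c : ℤ) : Y.HasSelfIntersection y c ↔ X.HasSelfIntersection y c := by
  have : {x ∈ Y.rays | x ≠ y ∧ {x, y} ∈ Y.cones} = {x ∈ X.rays | x ≠ y ∧ {x, y} ∈ X.cones} := by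
    ext x
    simp only [Finset.mem_filter]
    rw [pair_mem_coarse_iff h hyu hyv hyw]
    constructor
    · rintro ⟨-, h1, h2⟩
      exact ⟨mem_rays_of_mem h2 (by simp), h1, h2⟩
    · rintro ⟨-, h1, h2⟩
      exact ⟨mem_rays_of_mem ((pair_mem_coarse_iff h hyu hyv hyw).2 h2)
        (by simp), h1, h2⟩
  rw [HasSelfIntersection, HasSelfIntersection, this]

/-- Contracting a `(-1)`-curve increases the self-intersection of its neighbours by one. -/
theorem hasSelfIntersection_add_one (h : IsStarSubdivision X.cones Y.cones u v w 1 1) {c : ℤ}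
    (hc : X.HasSelfIntersection u c) : Y.HasSelfIntersection u (c + 1) := by
  have huw : {u, w} ∈ X.cones := (h.mem_fine _).2 (Or.inr ⟨by simp, Or.inl subset_rfl⟩)
  have hw : w = u + v := by
    refine toReal_injective ?_
    rw [h.eq, toReal_add, one_smul, one_smul]
  set A := X.rays.filter (fun x => x ≠ u ∧ {x, u} ∈ X.cones) with hA
  have hwA : w ∈ A := Finset.mem_filter.2
    ⟨mem_rays_of_mem huw (by simp), h.ne_left.symm, by rwa [Finset.pair_comm]⟩
  have hvA : v ∉ A := fun hv => h.not_subset_of_fine (Finset.mem_filter.1 hv).2.2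
    (by rw [Finset.pair_comm])
  have hB : {x ∈ Y.rays | x ≠ u ∧ {x, u} ∈ Y.cones} = insert v (A.erase w) := by
    ext x
    simp only [hA, Finset.mem_filter, Finset.mem_insert, Finset.mem_erase]
    constructor
    · rintro ⟨h0, h1, h2⟩
      rcases (h.mem_coarse _).1 h2 with h3 | h3
      · refine Or.inr ⟨?_, mem_rays_of_mem h3.1 (by simp), h1, h3.1⟩
        rintro rfl
        exact h3.2 (by simp)
      · have : x ∈ ({u, v} : Finset N) := by rw [← h3]; simp
        simp only [Finset.mem_insert, Finset.mem_singleton, h1, false_or] at this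
        exact Or.inl this
    · rintro (rfl | ⟨h1, h2, h3, h4⟩)
      · exact ⟨mem_rays_of_mem h.pair_mem (by simp), h.ne.symm,
          by rw [Finset.pair_comm]; exact h.pair_mem⟩
      · have : {x, u} ∈ Y.cones :=
          (h.mem_coarse _).2 (Or.inl ⟨h4, by simp [h1.symm, h.ne_left.symm]⟩)
        exact ⟨mem_rays_of_mem this (by simp), h3, this⟩
  rw [HasSelfIntersection, ← hA, ← Finset.add_sum_erase _ _ hwA] at hc
  rw [HasSelfIntersection, hB,
    Finset.sum_insert (fun h' => hvA (Finset.mem_of_mem_erase h')), ← hc, hw]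
  module

/-- If a toric surface has the rays `e`, `u`, `v`, and `e` lies on the same side of the line through
`u` as `v`, then it is not complete: its fan lies in a half-plane. -/
theorem ne_add_of_isComplete (hS : S.IsComplete) (hr : S.rays = {e, u, v}) (heu : e ≠ u)
    (hev : e ≠ v) (huv : u ≠ v) (hσ : {e, u} ∈ S.cones) (hb : 0 < b) :
    toReal e ≠ a • toReal u + b • toReal v := by
  intro h
  obtain ⟨f, hf, hfx⟩ := (isComplete_iff S).1 hS (-(toReal u + toReal v))
  have hfs : f.support ⊆ {e, u, v} := fun x hx => by
    rw [← hr]; exact mem_rays_of_mem hf.2 hx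
  have h1 : ((cross u v : ℤ) : ℝ) ≠ 0 := by
    intro h0
    have h2 : cross (toReal u) (toReal e) = 0 := by
      rw [h, cross_add_right, cross_smul_right, cross_smul_right, cross_self, cross_toReal, h0]
      ring
    rw [cross_swap, cross_toReal, neg_eq_zero] at h2
    exact cross_ne_zero hσ heu (by exact_mod_cast h2)
  have h2 := cross_realize (toReal u) hfs
  rw [hfx, Finset.sum_insert (by simp [heu, hev]), Finset.sum_pair huv, h] at h2
  have h3 : cross (toReal u) (-(toReal u + toReal v)) = -((cross u v : ℤ) : ℝ) := by
    rw [← neg_one_smul ℝ, cross_smul_right, cross_add_right, cross_self, cross_toReal]; ring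
  rw [h3, cross_add_right, cross_smul_right, cross_smul_right, cross_self, cross_toReal] at h2
  have h4 : (1 + f e * b + f v) * ((cross u v : ℤ) : ℝ) = 0 := by linarith
  have h5 := hf.1 e
  have h6 := hf.1 v
  rcases mul_eq_zero.1 h4 with h7 | h7
  · have : 0 ≤ f e * b := by positivity
    linarith
  · exact h1 h7

/-- The induction step of the cascade. Let `S` be a complete toric surface with three rays and `X`
its minimal resolution. If a curve `D_w` with `D_w² ≤ -3` meets a `(-1)`-curve `D_e`, then the
contraction `Y` of `D_e` is again the minimal resolution of a complete toric surface `Z` with three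
rays. The rays of `Z` are those of `S`, with `e` replaced by the other neighbour of `e` in `X`. -/
theorem IsMinimalRefinement.exists_contraction (h : X.IsMinimalRefinement S) (hS : S.IsComplete)
    (h3 : S.rays.card = 3) (he : X.IsMinusOneCurve e) (hwe : w ≠ e) (hσ : {w, e} ∈ X.cones)
    {c : ℤ} (hc : X.HasSelfIntersection w c) (hc3 : c < -2) :
    ∃ (Y Z : ToricSurface) (w' : N), IsStarSubdivision X.cones Y.cones w w' e 1 1 ∧
      Z.IsComplete ∧ Z.rays.card = 3 ∧ Y.IsMinimalRefinement Z := by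
  have heS : e ∈ S.rays := by
    by_contra heS
    exact h.not_minusOne e heS he
  have : ∃ (Y : ToricSurface) (w' : N), IsStarSubdivision X.cones Y.cones w w' e 1 1 ∧
      Y.IsComplete ∧ Y.IsSmooth := by
    obtain ⟨Y, p, q, hY, -, hYc, hYs⟩ := ToricSurface.exists_contraction h.complete h.smooth he
    rcases (hY.mem_fine _).1 hσ with h1 | ⟨-, h1 | h1⟩
    · exact absurd (by simp) (hY.notMem_of_coarse h1.1)
    · have := h1 (by simp : w ∈ _)
      simp only [Finset.mem_insert, Finset.mem_singleton, hwe, or_false] at this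
      exact ⟨Y, q, this ▸ hY, hYc, hYs⟩
    · have := h1 (by simp : w ∈ _)
      simp only [Finset.mem_insert, Finset.mem_singleton, hwe, or_false] at this
      exact ⟨Y, p, this ▸ hY.symm, hYc, hYs⟩
  obtain ⟨Y, w', hY, hYc, hYs⟩ := this
  have hsum : toReal e = toReal w + toReal w' := by rw [hY.eq, one_smul, one_smul]
  have hw'e : w' ≠ e := hY.ne_right
  have hσ' : {w', e} ∈ X.cones := (hY.mem_fine _).2 (Or.inr ⟨by simp, Or.inr subset_rfl⟩)
  have hw'p := X.primitive _ hσ' w' (by simp)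
  have hw'X : w' ∈ X.rays := mem_rays_of_mem hσ' (by simp)
  obtain ⟨u₁, a₁, b₁, heu₁, hτ₁, ha₁, hb₁, hw⟩ := h.refines.exists_edge heS hσ hwe
  obtain ⟨u₂, a₂, b₂, heu₂, hτ₂, ha₂, hb₂, hw'⟩ := h.refines.exists_edge heS hσ' hw'e
  -- two vectors in the same cone, off its edge `e`, cannot add up to `e`
  have hu₁₂ : u₁ ≠ u₂ := by
    rintro rfl
    have h1 : cross (toReal e) (toReal e) = (b₁ + b₂) * ((cross e u₁ : ℤ) : ℝ) := by
      nth_rw 2 [hsum]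
      rw [hw, hw', cross_add_right, cross_add_right, cross_add_right, cross_smul_right,
        cross_smul_right, cross_smul_right, cross_smul_right, cross_self, cross_toReal]
      ring
    rw [cross_self] at h1
    refine mul_ne_zero (by positivity) ?_ h1.symm
    exact_mod_cast cross_ne_zero hτ₁ heu₁
  have hu₁S : u₁ ∈ S.rays := mem_rays_of_mem hτ₁ (by simp)
  have hu₂S : u₂ ∈ S.rays := mem_rays_of_mem hτ₂ (by simp)
  have hrays : S.rays = {e, u₁, u₂} := by
    refine (Finset.eq_of_subset_of_card_le ?_ ?_).symm
    · simp only [Finset.insert_subset_iff, Finset.singleton_subset_iff]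
      exact ⟨heS, hu₁S, hu₂S⟩
    · rw [h3, Finset.card_insert_of_notMem (by simp [heu₁, heu₂]), Finset.card_pair hu₁₂]
  have ha₁1 : a₁ < 1 :=
    h.coord_lt_one heu₁ hτ₁ (mem_rays_of_mem hσ (by simp)) hwe ha₁ hb₁.le hw
  have hpos : 0 < 1 - a₁ := sub_pos.2 ha₁1
  -- since the `e`-coordinate of `w` is less than one, `e` lies between `u₁` and `w'`
  have he' : toReal e = (b₁ / (1 - a₁)) • toReal u₁ + (1 / (1 - a₁)) • toReal w' := by
    have h1 : (1 - a₁) • toReal e = b₁ • toReal u₁ + (1 : ℝ) • toReal w' := by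
      rw [sub_smul, one_smul, one_smul]
      nth_rw 1 [hsum]
      rw [hw]
      module
    rw [div_eq_inv_mul, div_eq_inv_mul, mul_smul, mul_smul, ← smul_add, ← h1, smul_smul,
      inv_mul_cancel₀ hpos.ne', one_smul]
  have hd₁ : 0 < b₁ / (1 - a₁) := div_pos hb₁ hpos
  have hd₂ : 0 < 1 / (1 - a₁) := one_div_pos.2 hpos
  -- otherwise the fan of `S` would lie in a half-plane
  have hw'u₂ : w' ≠ u₂ := by
    rintro rfl
    exact ne_add_of_isComplete hS hrays heu₁ heu₂ hu₁₂ hτ₁ hd₂ he'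
  have ha₂' : 0 < a₂ := by
    refine lt_of_le_of_ne ha₂ ?_
    rintro rfl
    rw [zero_smul, zero_add] at hw'
    exact hw'u₂ ((isPrimitive hu₂S).eq_of_toReal_eq_smul hw'p hb₂.le hw')
  -- `Z` arises from `S` by adding the ray `w'` and removing the ray `e`
  obtain ⟨S₁, hS₁⟩ := exists_starSubdivision S heu₂ hτ₂ hw'p ha₂' hb₂ hw'
  have hw'S := notMem_rays_of_isStarSubdivision hS₁
  have hu₁w' : u₁ ≠ w' := by rintro rfl; exact hw'S hu₁S
  have hu₁e : {u₁, e} ∈ S₁.cones := by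
    refine (hS₁.mem_fine _).2 (Or.inl ⟨by rwa [Finset.pair_comm], fun h1 => ?_⟩)
    have := h1 (by simp : u₂ ∈ _)
    simp [hu₁₂.symm, heu₂.symm] at this
  have hw'e₁ : {w', e} ∈ S₁.cones :=
    (hS₁.mem_fine _).2 (Or.inr ⟨by simp, Or.inl (by rw [Finset.pair_comm])⟩)
  obtain ⟨Z, hZ⟩ := exists_isStarSubdivision_of_neighbours S₁ hu₁w' heu₁.symm hw'e hu₁e hw'e₁
    (fun x hx hxc => by
      rcases (hS₁.mem_fine _).1 hxc with h1 | h1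
      · have h2 : x ∈ S.rays := mem_rays_of_mem h1.1 (by simp)
        simp only [hrays, Finset.mem_insert, Finset.mem_singleton, hx, false_or] at h2
        rcases h2 with rfl | rfl
        · exact Or.inl rfl
        · exact absurd subset_rfl h1.2
      · have h2 := h1.1
        simp only [Finset.mem_insert, Finset.mem_singleton, hw'e, false_or] at h2
        exact Or.inr h2.symm) hd₁ hd₂ he'
  have hr₁ := rays_of_isStarSubdivision hS₁
  have hr₂ := rays_of_isStarSubdivision hZ
  have hrY := rays_of_isStarSubdivision hY
  have heZ := notMem_rays_of_isStarSubdivision hZ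
  have hZc : Z.IsComplete :=
    (isComplete_iff_of_isStarSubdivision hZ).1 ((isComplete_iff_of_isStarSubdivision hS₁).2 hS)
  have hmemZ : ∀ x, x ∈ Z.rays ↔ x ≠ e ∧ (x = w' ∨ x ∈ S.rays) := by
    intro x
    rw [← Finset.mem_insert, ← hr₁, hr₂, Finset.mem_insert]
    constructor
    · exact fun hx => ⟨by rintro rfl; exact heZ hx, Or.inr hx⟩
    · rintro ⟨h1, h2⟩
      exact h2.resolve_left h1
  refine ⟨Y, Z, w', hY, hZc, ?_, ⟨hYc, hYs, ?_, ?_, ?_⟩⟩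
  · have h1 := congrArg Finset.card (hr₁.symm.trans hr₂)
    rw [Finset.card_insert_of_notMem hw'S, Finset.card_insert_of_notMem heZ, h3] at h1
    omega
  · -- the cone `{e, u₁}` of `S` lies in `{u₁, w'}`; the rays in `{e, u₂}` other than `e` in
    -- `{w', u₂}`
    have hτZ : {u₁, w'} ∈ Z.cones := hZ.pair_mem
    have heτ : toReal e ∈ cone {u₁, w'} := mem_cone_pair.2 ⟨_, _, hd₁.le, hd₂.le, he'⟩
    have hsub₁ : cone {e, u₁} ≤ cone {u₁, w'} := cone_le fun x hx => by
      rcases Finset.mem_insert.1 hx with rfl | hx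
      · exact heτ
      · rw [Finset.mem_singleton.1 hx]; exact toReal_mem_cone (by simp)
    have hτZ' : {u₂, w'} ∈ Z.cones := (hZ.mem_coarse _).2 (Or.inl
      ⟨(hS₁.mem_fine _).2 (Or.inr ⟨by simp, Or.inr subset_rfl⟩), by simp [heu₂, hw'e.symm]⟩)
    intro σ hσY
    rcases (hY.mem_coarse σ).1 hσY with ⟨hσX, heσ⟩ | rfl
    · obtain ⟨τ, hτ, hστ⟩ := h.refines σ hσX
      by_cases heτ' : e ∈ τ
      · have hτ' : τ ⊆ {e, u₁} ∨ τ = {e, u₂} := by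
          rcases eq_singleton_or_pair hτ heτ' with rfl | ⟨x, hx, rfl⟩
          · exact Or.inl (by simp)
          · have h2 : x ∈ S.rays := mem_rays_of_mem hτ (by simp)
            simp only [hrays, Finset.mem_insert, Finset.mem_singleton, hx, false_or] at h2
            rcases h2 with rfl | rfl
            · exact Or.inl subset_rfl
            · exact Or.inr rfl
        rcases hτ' with hτ' | rfl
        · exact ⟨_, hτZ, fun x hx => hsub₁ (cone_mono hτ' (hστ x hx))⟩
        · refine ⟨_, hτZ', fun x hx => ?_⟩
          obtain ⟨s, t, hs, ht, hxst⟩ := mem_cone_pair.1 (hστ x hx)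
          rcases le_total (s / a₂) (t / b₂) with hle | hle
          · refine mem_cone_pair.2 ⟨t - s / a₂ * b₂, s / a₂, ?_, by positivity, ?_⟩
            · rwa [sub_nonneg, ← le_div_iff₀ hb₂]
            · rw [hxst, hw', smul_add, smul_smul, smul_smul, div_mul_cancel₀ _ ha₂'.ne']
              module
          · have hx' : toReal x ∈ cone {w', e} := by
              refine mem_cone_pair.2 ⟨t / b₂, s - t / b₂ * a₂, by positivity, ?_, ?_⟩
              · rwa [sub_nonneg, ← le_div_iff₀ ha₂']
              · rw [hxst, hw', smul_add, smul_smul, smul_smul, div_mul_cancel₀ _ hb₂.ne']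
                module
            have h1 := mem_of_toReal_mem_cone hσ' (mem_rays_of_mem hσX hx) hx'
            have hxe : x ≠ e := by rintro rfl; exact heσ hx
            simp only [Finset.mem_insert, Finset.mem_singleton, hxe, or_false] at h1
            rw [h1]
            exact toReal_mem_cone (by simp)
      · refine ⟨τ, (hZ.mem_coarse _).2 (Or.inl ⟨(hS₁.mem_fine _).2 (Or.inl ⟨hτ, fun h1 => ?_⟩),
          heτ'⟩), hστ⟩
        exact heτ' (h1 (by simp))
    · refine ⟨_, hτZ, fun x hx => ?_⟩
      rcases Finset.mem_insert.1 hx with rfl | hx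
      · exact hsub₁ (mem_cone_pair.2 ⟨a₁, b₁, ha₁, hb₁.le, hw⟩)
      · rw [Finset.mem_singleton.1 hx]; exact toReal_mem_cone (by simp)
  · intro x hx
    obtain ⟨h1, h2⟩ := (hmemZ x).1 hx
    have : x ∈ X.rays := by
      rcases h2 with rfl | h2
      · exact hw'X
      · exact h.rays_subset h2
    rw [hrY, Finset.mem_insert] at this
    exact this.resolve_left h1
  · rintro v hvZ ⟨hvY, hv⟩
    have hve : v ≠ e := by
      rintro rfl
      exact notMem_rays_of_isStarSubdivision hY hvY
    have hvX : v ∈ X.rays := by rw [hrY]; exact Finset.mem_insert_of_mem hvY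
    rw [hmemZ] at hvZ
    have hvw' : v ≠ w' := fun h1 => hvZ ⟨hve, Or.inl h1⟩
    have hvS : v ∉ S.rays := fun h1 => hvZ ⟨hve, Or.inr h1⟩
    rcases eq_or_ne v w with rfl | hvw
    · -- `D_w` has self-intersection `c + 1 < -1` on `Y`
      have h1 := hasSelfIntersection_add_one hY hc
      rw [HasSelfIntersection] at h1 hv
      have h2 := add_right_cancel (h1.trans hv.symm)
      have h3 := smul_left_injective ℤ (isPrimitive hvX).ne_zero h2
      omega
    · exact h.not_minusOne v hvS
        ⟨hvX, (hasSelfIntersection_iff_of_isStarSubdivision hY hvw hvw' hve _).1 hv⟩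

end ToricSurface

/-! ### Picard number, log terminality and ampleness -/

/-- The determinant with a fixed lattice vector, as a character. -/
def crossDual (u : N) : M where
  toFun := cross u
  map_add' := cross_add_right u
  map_smul' c v := cross_smul_right u v c

@[simp]
theorem crossDual_apply (u v : N) : crossDual u v = cross u v := rfl

/-- A character, as a linear form on `N_ℝ`. -/
noncomputable def dualReal (m : M) : NR →ₗ[ℝ] ℝ :=
  ((m (Pi.single 0 1) : ℤ) : ℝ) • LinearMap.proj 0 +
    ((m (Pi.single 1 1) : ℤ) : ℝ) • LinearMap.proj 1

theorem dualReal_toReal (m : M) (v : N) : dualReal m (toReal v) = (m v : ℤ) := by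
  have hv : v = v 0 • Pi.single 0 1 + v 1 • Pi.single 1 1 := by
    ext i; fin_cases i <;> simp
  have h : m v = v 0 * m (Pi.single 0 1) + v 1 * m (Pi.single 1 1) := by
    conv_lhs => rw [hv, map_add, map_smul, map_smul]
    simp only [smul_eq_mul]
  rw [h]
  simp [dualReal, toReal]
  ring

theorem dualReal_realize (m : M) {f : N →₀ ℝ} {σ : Finset N} (h : f.support ⊆ σ) :
    dualReal m (realize f) = ∑ v ∈ σ, f v * (m v : ℤ) := by
  rw [realize_eq_sum h, map_sum]
  exact Finset.sum_congr rfl fun v _ => by rw [map_smul, dualReal_toReal, smul_eq_mul]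

namespace ToricSurface

variable (X : ToricSurface)

theorem exists_common_index :
    ∃ n : ℤ, 0 < n ∧ ∀ σ ∈ X.cones, ∀ u ∈ σ, ∀ v ∈ σ, u ≠ v → cross u v ∣ n := by
  refine ⟨∏ u ∈ X.rays, ∏ v ∈ X.rays, if cross u v = 0 then 1 else |cross u v|,
    Finset.prod_pos fun u _ => Finset.prod_pos fun v _ => ?_, fun σ hσ u hu v hv huv => ?_⟩
  · split_ifs with h
    · exact one_pos
    · exact abs_pos.2 h
  · have h0 : cross u v ≠ 0 := cross_ne_zero (X.face_mem σ hσ _ (by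
      simp only [Finset.insert_subset_iff, Finset.singleton_subset_iff]
      exact ⟨hu, hv⟩)) huv
    have h1 : cross u v ∣ if cross u v = 0 then 1 else |cross u v| := by
      rw [if_neg h0]; exact self_dvd_abs _
    exact h1.trans ((Finset.dvd_prod_of_mem _ (mem_rays_of_mem hσ hv)).trans
      (Finset.dvd_prod_of_mem (fun u => ∏ v ∈ X.rays, if cross u v = 0 then 1 else |cross u v|)
        (mem_rays_of_mem hσ hu)))

variable {X}

theorem exists_dual_eq {σ : Finset N} (hσ : σ ∈ X.cones) {n : ℤ}
    (hn : ∀ u ∈ σ, ∀ v ∈ σ, u ≠ v → cross u v ∣ n) (g : N → ℤ) :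
    ∃ m : M, ∀ v ∈ σ, m v = n * g v := by
  rcases σ.eq_empty_or_nonempty with rfl | ⟨v, hv⟩
  · exact ⟨0, by simp⟩
  rcases eq_singleton_or_pair hσ hv with rfl | ⟨u, hu, rfl⟩
  · obtain ⟨w, hw⟩ := (X.primitive _ hσ v hv).exists_cross_eq_one
    refine ⟨-(n * g v) • crossDual w, fun x hx => ?_⟩
    rw [Finset.mem_singleton.1 hx, LinearMap.smul_apply, crossDual_apply, cross_swap, hw,
      smul_eq_mul]
    ring
  · obtain ⟨k, hk⟩ := hn v (by simp) u (by simp) hu.symm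
    refine ⟨-(k * g v) • crossDual u + (k * g u) • crossDual v, fun x hx => ?_⟩
    rcases Finset.mem_insert.1 hx with rfl | hx
    · simp only [LinearMap.add_apply, LinearMap.smul_apply, crossDual_apply, cross_self,
        smul_eq_mul]
      rw [cross_swap, hk]; ring
    · rw [Finset.mem_singleton.1 hx]
      simp only [LinearMap.add_apply, LinearMap.smul_apply, crossDual_apply, cross_self,
        smul_eq_mul]
      rw [hk]; ring

/-- Every divisor on a toric surface is `ℚ`-Cartier. -/
theorem exists_smul_mem_cartierDiv (X : ToricSurface) :
    ∃ n : ℤ, 0 < n ∧ ∀ D : X.Div, n • D ∈ X.cartierDiv := by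
  obtain ⟨n, hn, hdvd⟩ := X.exists_common_index
  refine ⟨n, hn, fun D σ hσ => ?_⟩
  obtain ⟨m, hm⟩ := exists_dual_eq hσ (hdvd σ hσ)
    (fun v => if hv : v ∈ X.rays then -D ⟨v, hv⟩ else 0)
  refine ⟨m, fun v hv => ?_⟩
  rw [hm v hv, dif_pos v.2]
  simp

theorem divChar_injective (hX : X.IsComplete) : Function.Injective X.divChar := by
  rw [injective_iff_map_eq_zero]
  intro m hm
  ext1 i
  obtain ⟨f, hf, hfx⟩ := X.isComplete_iff.1 hX (toReal (Pi.single i 1))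
  have h := dualReal_realize m (subset_refl f.support)
  rw [hfx, dualReal_toReal, Finset.sum_eq_zero] at h
  · ext
    simpa using h
  · intro v hv
    have : m v = 0 := congrFun hm ⟨v, mem_rays_of_mem hf.2 hv⟩
    rw [this, Int.cast_zero, mul_zero]

/-- The Picard number of a complete toric surface is the number of rays minus two. -/
theorem picardNumber_add_two (hX : X.IsComplete) : X.picardNumber + 2 = X.rays.card := by
  have hle : LinearMap.range X.divChar ≤ X.cartierDiv := by
    rintro _ ⟨m, rfl⟩ σ -
    exact ⟨-m, fun v _ => by simp [divChar]⟩
  have h1 : Module.finrank ℤ ((LinearMap.range X.divChar).submoduleOf X.cartierDiv) = 2 := by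
    rw [(Submodule.submoduleOfEquivOfLe hle).finrank_eq,
      LinearMap.finrank_range_of_inj (divChar_injective hX)]
    simp [Module.finrank_linearMap]
  have h2 : Module.finrank ℤ X.Div = X.rays.card := by
    rw [Module.finrank_fintype_fun_eq_card, Fintype.card_coe]
  have h3 : Module.finrank ℤ X.cartierDiv = X.rays.card := by
    refine le_antisymm (h2 ▸ Submodule.finrank_le _) ?_
    obtain ⟨n, hn, hc⟩ := X.exists_smul_mem_cartierDiv
    rw [← h2]
    refine LinearMap.finrank_le_finrank_of_injective
      (f := LinearMap.codRestrict X.cartierDiv (n • LinearMap.id) hc) ?_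
    intro D E hDE
    have : n • D = n • E := congrArg Subtype.val hDE
    exact smul_right_injective _ hn.ne' this
  have h4 := Submodule.finrank_quotient_add_finrank
    ((LinearMap.range X.divChar).submoduleOf X.cartierDiv)
  rwa [h1, h3] at h4

theorem isLogTerminal (X : ToricSurface) : X.IsLogTerminal := by
  obtain ⟨n, hn, hdvd⟩ := X.exists_common_index
  intro σ hσ
  obtain ⟨m, hm⟩ := exists_dual_eq hσ (hdvd σ hσ) (fun _ => 1)
  simp only [mul_one] at hm
  refine ⟨n, hn, m, hm, fun w hw hwσ => ?_⟩
  obtain ⟨f, hf, hfs, hfx⟩ := mem_cone_iff.1 hwσ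
  have h := dualReal_realize m hfs
  have hn' : (0 : ℝ) < n := by exact_mod_cast hn
  have hpos : ∀ v ∈ σ, 0 ≤ f v * (m v : ℤ) := fun v hv => by
    rw [hm v hv]; exact mul_nonneg (hf v) hn'.le
  rw [hfx, dualReal_toReal] at h
  have h0 : (0 : ℝ) < (m w : ℤ) := by
    rw [h]
    refine lt_of_le_of_ne (Finset.sum_nonneg hpos) fun h0 => hw.ne_zero ?_
    have hz := (Finset.sum_eq_zero_iff_of_nonneg hpos).1 h0.symm
    refine toReal_injective ?_
    rw [toReal_zero, ← hfx, realize_eq_sum hfs]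
    refine Finset.sum_eq_zero fun v hv => ?_
    have h1 := hz v hv
    rw [hm v hv] at h1
    rw [(mul_eq_zero.1 h1).resolve_right hn'.ne', zero_smul]
  exact_mod_cast h0

/-- On a complete toric surface with three rays the anticanonical divisor is ample. If the character
`m` is `-n` on two of the rays, then it is nonnegative on the third ray `v`, since `-v` is a
nonnegative combination of the three rays. -/
theorem isAmple_neg_canonicalDiv (hX : X.IsComplete) (h3 : X.rays.card = 3) :
    X.IsAmple (-X.canonicalDiv) := by
  obtain ⟨n, hn, hdvd⟩ := X.exists_common_index
  obtain ⟨k, hk, hkc⟩ := X.exists_smul_mem_cartierDiv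
  have hnk : 0 < n * k := mul_pos hn hk
  refine ⟨n * k, hnk, ?_, fun σ hσ hcard => ?_⟩
  · rw [mul_smul]
    exact X.cartierDiv.smul_mem n (hkc _)
  obtain ⟨m, hm⟩ := exists_dual_eq hσ (n := n * k)
    (fun u hu v hv huv => (hdvd σ hσ u hu v hv huv).mul_right k) (fun _ => -1)
  refine ⟨m, fun v => ⟨fun hv => ?_, fun hv => ?_⟩⟩
  · rw [hm v hv]; simp [canonicalDiv]
  · have hrays : X.rays = insert (v : N) σ := by
      refine (Finset.eq_of_subset_of_card_le ?_ ?_).symm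
      · exact Finset.insert_subset v.2 fun x hx => mem_rays_of_mem hσ hx
      · rw [h3, Finset.card_insert_of_notMem hv, hcard]
    obtain ⟨f, hf, hfx⟩ := X.isComplete_iff.1 hX (toReal (-(v : N)))
    have hfs : f.support ⊆ insert (v : N) σ := fun x hx => by
      rw [← hrays]; exact mem_rays_of_mem hf.2 hx
    have h := dualReal_realize m hfs
    rw [hfx, dualReal_toReal, Finset.sum_insert hv, map_neg] at h
    have hle : ∑ x ∈ σ, f x * ((m x : ℤ) : ℝ) ≤ 0 := by
      refine Finset.sum_nonpos fun x hx => mul_nonpos_of_nonneg_of_nonpos (hf.1 x) ?_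
      rw [hm x hx]
      exact_mod_cast (by linarith : n * k * -1 ≤ 0)
    have hfv := hf.1 v
    have h5 : (0 : ℝ) ≤ (1 + f v) * ((m v : ℤ) : ℝ) := by
      push_cast at h
      linarith
    have h6 : (0 : ℝ) ≤ ((m v : ℤ) : ℝ) := nonneg_of_mul_nonneg_right h5 (by linarith)
    have h7 : 0 ≤ m v := by exact_mod_cast h6
    simp only [canonicalDiv, Pi.neg_apply, neg_neg, mul_one]
    linarith

theorem isLogDelPezzoOfPicardNumberOne_iff :
    X.IsLogDelPezzoOfPicardNumberOne ↔ X.IsComplete ∧ X.rays.card = 3 := by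
  constructor
  · rintro ⟨⟨hX, -, -⟩, h⟩
    have := picardNumber_add_two hX
    exact ⟨hX, by omega⟩
  · rintro ⟨hX, h3⟩
    have := picardNumber_add_two hX
    exact ⟨⟨hX, X.isLogTerminal, isAmple_neg_canonicalDiv hX h3⟩, by omega⟩

end ToricSurface

/-! ### The cascade -/

namespace ToricSurface

variable {X Y S : ToricSurface}

/-- The toric morphism given by the identity of the lattice. -/
def Refines.toMorphism (h : X.Refines Y) : ToricMorphism X Y where
  toLinearMap := LinearMap.id
  map_cone := h

theorem Refines.isProperBirational (h : X.Refines Y) (hX : X.IsComplete) :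
    h.toMorphism.IsProperBirational :=
  ⟨Function.bijective_id, fun v _ => by rw [hX]; trivial⟩

theorem IsMinimalRefinement.isMinimalResolution (h : X.IsMinimalRefinement S) :
    h.refines.toMorphism.IsMinimalResolution :=
  ⟨h.smooth, h.refines.isProperBirational h.complete, fun v hv => h.not_minusOne v hv.2⟩

theorem isBlowDown_of_isStarSubdivision {u v e : N} {a b : ℝ}
    (h : IsStarSubdivision X.cones Y.cones u v e a b) (hX : X.IsComplete) (hXs : X.IsSmooth)
    (hYs : Y.IsSmooth) (he : X.IsMinusOneCurve e) :
    (refines_of_isStarSubdivision h).toMorphism.IsBlowDown := by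
  refine ⟨hXs, hYs, (refines_of_isStarSubdivision h).isProperBirational hX, e, he, fun x => ?_⟩
  change x ∈ X.rays ∧ x ∉ Y.rays ↔ x = e
  rw [rays_of_isStarSubdivision h, Finset.mem_insert]
  constructor
  · rintro ⟨h1, h2⟩
    exact h1.resolve_right h2
  · rintro rfl
    exact ⟨Or.inl rfl, notMem_rays_of_isStarSubdivision h⟩

theorem IsMinimalRefinement.exists_cascade (h : X.IsMinimalRefinement S) (hS : S.IsComplete)
    (h3 : S.rays.card = 3) :
    ∃ (t : ℕ) (T T' : ℕ → ToricSurface), T t = S ∧ T' t = X ∧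
      (∀ k ≤ t, (T k).IsLogDelPezzoOfPicardNumberOne) ∧
      (∀ k ≤ t, ∃ π : ToricMorphism (T' k) (T k), π.IsMinimalResolution) ∧
      (∀ k < t, ∃ φ : ToricMorphism (T' (k + 1)) (T' k), φ.IsBlowDown) ∧
      (T 0).IsBasic := by
  induction hn : X.rays.card using Nat.strong_induction_on generalizing X S with
  | _ n ih =>
    have hLDP := isLogDelPezzoOfPicardNumberOne_iff.2 ⟨hS, h3⟩
    by_cases hbasic : ∀ e v, X.IsMinusOneCurve e → v ∈ X.rays → v ≠ e → {v, e} ∈ X.cones →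
      ∀ b, X.HasSelfIntersection v b → -2 ≤ b
    · exact ⟨0, fun _ => S, fun _ => X, rfl, rfl, fun _ _ => hLDP,
        fun _ _ => ⟨_, h.isMinimalResolution⟩, fun k hk => absurd hk k.not_lt_zero,
        X, _, h.isMinimalResolution, hbasic⟩
    push Not at hbasic
    obtain ⟨e, w, he, -, hwe, hσ, c, hc, hc3⟩ := hbasic
    obtain ⟨Y, Z, w', hY, hZ, hZ3, hYZ⟩ := h.exists_contraction hS h3 he hwe hσ hc hc3
    have hlt : Y.rays.card < n := by
      rw [← hn, rays_of_isStarSubdivision hY,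
        Finset.card_insert_of_notMem (notMem_rays_of_isStarSubdivision hY)]
      exact Nat.lt_succ_self _
    obtain ⟨t, T, T', hT, hT', h1, h2, h4, h5⟩ := ih _ hlt hYZ hZ hZ3 rfl
    refine ⟨t + 1, fun k => if k ≤ t then T k else S, fun k => if k ≤ t then T' k else X,
      by simp, by simp, fun k _ => ?_, fun k _ => ?_, fun k hk => ?_, by simpa using h5⟩
    · dsimp only
      split_ifs with hkt
      · exact h1 k hkt
      · exact hLDP
    · dsimp only
      by_cases hkt : k ≤ t
      · rw [if_pos hkt, if_pos hkt]
        exact h2 k hkt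
      · rw [if_neg hkt, if_neg hkt]
        exact ⟨_, h.isMinimalResolution⟩
    · dsimp only
      rcases (Nat.lt_succ_iff.1 hk).lt_or_eq with hkt | rfl
      · rw [if_pos hkt.le, if_pos (Nat.succ_le_of_lt hkt)]
        exact h4 k hkt
      · rw [if_pos le_rfl, if_neg (by omega), hT']
        exact ⟨_, isBlowDown_of_isStarSubdivision hY h.complete h.smooth hYZ.smooth he⟩

end ToricSurface

end Toric

theorem mainTheorem1 (S : Toric.ToricSurface) (hS : S.IsLogDelPezzoOfPicardNumberOne) :
    S.AdmitsCascade := by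
  obtain ⟨hc, h3⟩ := Toric.ToricSurface.isLogDelPezzoOfPicardNumberOne_iff.1 hS
  obtain ⟨X, hX⟩ := Toric.ToricSurface.exists_isMinimalRefinement hc
  obtain ⟨t, T, T', h1, -, h2⟩ := hX.exists_cascade hc h3
  exact ⟨t, T, T', h1, h2⟩
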